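/- Let $(X,d)$ be a locally compact separable metric space and $m$ a finite nonnegative Radon (Borel) measure on $X$ with $m(U)>0$ for every nonempty open $U\subset X$. Let $(\mathcal{E},\mathcal{D}(\mathcal{E}))$ be a symmetric Dirichlet form on $L^2(X,m)$, that is, $\mathcal{D}(\mathcal{E})$ is a dense subspace of $L^2(X,m)$ and $\mathcal{E}$ is a symmetric nonnegative definite bilinear form on it such that $\mathcal{D}(\mathcal{E})$ is complete with respect to $\mathcal{E}_1(f,g)=\mathcal{E}(f,g)+\langle f,g\rangle_{L^2(X,m)}$, and $f\in\mathcal{D}(\mathcal{E})$ implies $(0\vee f)\wedge 1\in\mathcal{D}(\mathcal{E})$ with $\mathcal{E}((0\vee f)\wedge 1)\le\mathcal{E}(f)$, where $\mathcal{E}(f):=\mathcal{E}(f,f)$. A core is a subset of $C_c(X)\cap\mathcal{D}(\mathcal{E})$ which is uniformly dense in $C_c(X)$ and dense in $(\mathcal{E}_1,\mathcal{D}(\mathcal{E}))$. Assume: (a) (strong locality) $\mathcal{E}(f,g)=0$ for all $f,g\in C_c(X)\cap\mathcal{D}(\mathcal{E})$ such that $g$ is constant on a neighborhood of $\operatorname{supp}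 f$; (b) (carré du champ) for all $f,g\in C_c(X)\cap\mathcal{D}(\mathcal{E})$ there is $\Gamma(f,g)\in L^1(X,m)$ such that $$\tfrac12\{\mathcal{E}(fh,g)+\mathcal{E}(gh,f)-\mathcal{E}(fg,h)\}=\int_X h\,\Gamma(f,g)\,dm\qquad\text{for all } h\in C_c(X)\cap\mathcal{D}(\mathcal{E});$$ (c) $\mathcal{A}$ is an algebra of functions which is a core for $(\mathcal{E},\mathcal{D}(\mathcal{E}))$ (in particular the form is regular), and $\Gamma(f,g)\in L^\infty(X,m)$ for all $f,g\in\mathcal{A}$. Write $\Gamma(f)=\Gamma(f,f)$, and denote also by $f\mapsto\Gamma(f)\in L^1(X,m)$ its continuous extension from $C_c(X)\cap\mathcal{D}(\mathcal{E})$ to the space $\mathcal{D}(\mathcal{E})$ with the $\mathcal{E}_1$-norm. Let $(\mathcal{L},\mathcal{D}(\mathcal{L}))$ be the generator of the form, i.e. the non-positive definite self-adjoint operator with $\mathcal{E}(f,g)=-\langle\mathcal{L}f,g\rangle_{L^2(X,m)}$ for $f\in\mathcal{D}(\mathcal{L})$, $g\in\mathcal{D}(\mathcal{E})$. For $1<p<\infty$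 and $f\in\mathcal{A}$ put $\mathcal{E}^{(p)}(f)=\int_X\Gamma(f)^{p/2}\,dm$. The functional $(\mathcal{E}^{(p)},\mathcal{A})$ is called closable in $L^p(X,m)$ if $\lim_n\mathcal{E}^{(p)}(f_n)=0$ for every sequence $(f_n)_n\subset\mathcal{A}$ that is Cauchy in the seminorm $\mathcal{E}^{(p)}(\cdot)^{1/p}$ and satisfies $\lim_n f_n=0$ in $L^p(X,m)$. Assumption (AL): there is a linear space $\mathcal{A}_{\mathcal{L}}\subset\mathcal{D}(\mathcal{L})$, dense in $\mathcal{D}(\mathcal{E})$ with respect to the $\mathcal{E}_1$-norm, such that $\Gamma(f)\in L^\infty(X,m)$ and $\mathcal{L}f\in L^\infty(X,m)$ for all $f\in\mathcal{A}_{\mathcal{L}}$. Then: (i) for every $2\le p<\infty$ the functional $(\mathcal{E}^{(p)},\mathcal{A})$ is closable in $L^p(X,m)$; (ii) if (AL) holds, then $(\mathcal{E}^{(p)},\mathcal{A})$ is closable in $L^p(X,m)$ also for every $1<p<2$; (iii) consequently, for every $2\le p<\infty$, and under (AL) for every $1<p<2$, the following holds. Let $H_0^{1,p}(X,m)$ be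 the set of all $f\in L^p(X,m)$ for which there is a sequence $(f_n)_n\subset\mathcal{A}$ that is Cauchy in the seminorm $\mathcal{E}^{(p)}(\cdot)^{1/p}$ and converges to $f$ in $L^p(X,m)$. Then $H_0^{1,p}(X,m)$ is a linear subspace of $L^p(X,m)$; for every $f\in H_0^{1,p}(X,m)$ the limit $\mathcal{E}^{(p)}(f):=\lim_n\mathcal{E}^{(p)}(f_n)$ exists and is the same for all such sequences; and $H_0^{1,p}(X,m)$ is a Banach space with the norm $\|f\|_{L^p(X,m)}+\mathcal{E}^{(p)}(f)^{1/p}$. -/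

import Mathlib

open MeasureTheory Filter Topology
open scoped CompactlySupported ENNReal

section LpPreliminaries

variable {X : Type*} [MeasurableSpace X] {m : Measure X}

theorem lipschitzWith_unitCut : LipschitzWith 1 (fun t : ℝ => min (max 0 t) 1) :=
  (LipschitzWith.id.const_max 0).min_const 1

/-- The unit contraction `(0 ∨ u) ∧ 1` of an element `u` of `L²(X, m)`. -/
noncomputable def unitContraction (u : Lp ℝ 2 m) : Lp ℝ 2 m :=
  lipschitzWith_unitCut.compLp (by simp) u

end LpPreliminaries

/-- A symmetric Dirichlet form on (real) `L²(X, m)`: a densely defined, symmetric, nonnegative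
definite, closed bilinear form with the Markov property. -/
structure DirichletForm {X : Type*} [MeasurableSpace X] (m : Measure X) where
  /-- The domain `𝒟(ℰ)`. -/
  dom : Submodule ℝ (Lp ℝ 2 m)
  /-- The bilinear form `ℰ`. -/
  form : dom →ₗ[ℝ] dom →ₗ[ℝ] ℝ
  dense_dom : Dense (dom : Set (Lp ℝ 2 m))
  symm : ∀ u v : dom, form u v = form v u
  nonneg : ∀ u : dom, 0 ≤ form u u
  /-- The domain is complete for the norm of `ℰ₁(u, v) = ℰ(u, v) + ⟨u, v⟩`. -/
  closed : ∀ u : ℕ → dom,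
    (∀ ε : ℝ, 0 < ε → ∃ N : ℕ, ∀ n, N ≤ n → ∀ k, N ≤ k →
      form (u n - u k) (u n - u k) + ‖((u n - u k : dom) : Lp ℝ 2 m)‖ ^ 2 < ε) →
    ∃ v : dom, Tendsto
      (fun n => form (u n - v) (u n - v) + ‖((u n - v : dom) : Lp ℝ 2 m)‖ ^ 2) atTop (𝓝 0)
  markov : ∀ u : dom, ∃ h : unitContraction (u : Lp ℝ 2 m) ∈ dom,
    form ⟨unitContraction (u : Lp ℝ 2 m), h⟩ ⟨unitContraction (u : Lp ℝ 2 m), h⟩ ≤ form u u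

namespace DirichletForm

section General

variable {X : Type*} [MeasurableSpace X] {m : Measure X}

/-- The squared norm `ℰ₁(u) = ℰ(u, u) + ‖u‖²` on the domain. -/
noncomputable def normSq (E : DirichletForm m) (u : E.dom) : ℝ :=
  E.form u u + ‖(u : Lp ℝ 2 m)‖ ^ 2

open Classical in
/-- The value `ℰ(u, v)` for `u v : L²(X, m)` lying in the domain (and `0` otherwise). It spares
carrying along proofs that products of functions of `C_c(X) ∩ 𝒟(ℰ)` lie in `𝒟(ℰ)` again, which is
always the case by the Markov property. -/
noncomputable def val (E : DirichletForm m) (u v : Lp ℝ 2 m) : ℝ :=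
  if h : u ∈ E.dom ∧ v ∈ E.dom then E.form ⟨u, h.1⟩ ⟨v, h.2⟩ else 0

/-- `u ∈ 𝒟(ℰ)` and `ℰ(u, g) = -⟨w, g⟩` for all `g ∈ 𝒟(ℰ)`. -/
def GeneratorRel (E : DirichletForm m) (u w : Lp ℝ 2 m) : Prop :=
  ∃ hu : u ∈ E.dom, ∀ g : E.dom, E.form ⟨u, hu⟩ g = -inner ℝ w (g : Lp ℝ 2 m)

theorem GeneratorRel.unique {E : DirichletForm m} {u w w' : Lp ℝ 2 m}
    (h : E.GeneratorRel u w) (h' : E.GeneratorRel u w') : w = w' := by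
  obtain ⟨hu, h⟩ := h
  obtain ⟨hu', h'⟩ := h'
  refine E.dense_dom.eq_of_inner_left ℝ (fun v hv => ?_)
  have h1 := h ⟨v, hv⟩
  have h2 := h' ⟨v, hv⟩
  simp only at h1 h2
  linarith

theorem GeneratorRel.add {E : DirichletForm m} {u w u' w' : Lp ℝ 2 m}
    (h : E.GeneratorRel u w) (h' : E.GeneratorRel u' w') :
    E.GeneratorRel (u + u') (w + w') := by
  obtain ⟨hu, h⟩ := h
  obtain ⟨hu', h'⟩ := h'
  refine ⟨E.dom.add_mem hu hu', fun g => ?_⟩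
  have : (⟨u + u', E.dom.add_mem hu hu'⟩ : E.dom) = ⟨u, hu⟩ + ⟨u', hu'⟩ := rfl
  rw [this, map_add, LinearMap.add_apply, h, h', inner_add_left]
  ring

theorem GeneratorRel.smul {E : DirichletForm m} {u w : Lp ℝ 2 m} (c : ℝ)
    (h : E.GeneratorRel u w) : E.GeneratorRel (c • u) (c • w) := by
  obtain ⟨hu, h⟩ := h
  refine ⟨E.dom.smul_mem c hu, fun g => ?_⟩
  have : (⟨c • u, E.dom.smul_mem c hu⟩ : E.dom) = c • ⟨u, hu⟩ := rfl
  rw [this, map_smul, LinearMap.smul_apply, h, real_inner_smul_left, smul_eq_mul]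
  ring

theorem GeneratorRel.zero (E : DirichletForm m) : E.GeneratorRel 0 0 := by
  refine ⟨E.dom.zero_mem, fun g => ?_⟩
  have : (⟨0, E.dom.zero_mem⟩ : E.dom) = 0 := rfl
  rw [this, map_zero, LinearMap.zero_apply, inner_zero_left, neg_zero]

/-- The generator `(ℒ, 𝒟(ℒ))`: the domain consists of all `u ∈ 𝒟(ℰ)` for which there is
`ℒ u ∈ L²(X, m)` with `ℰ(u, g) = -⟨ℒ u, g⟩` for all `g ∈ 𝒟(ℰ)`. -/
noncomputable def generator (E : DirichletForm m) : Lp ℝ 2 m →ₗ.[ℝ] Lp ℝ 2 m where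
  domain :=
    { carrier := {u | ∃ w, E.GeneratorRel u w}
      add_mem' := fun ⟨_, h⟩ ⟨_, h'⟩ => ⟨_, h.add h'⟩
      zero_mem' := ⟨0, GeneratorRel.zero E⟩
      smul_mem' := fun c _ ⟨_, h⟩ => ⟨_, h.smul c⟩ }
  toFun :=
    { toFun := fun u => u.2.choose
      map_add' := fun u v =>
        (u + v).2.choose_spec.unique (u.2.choose_spec.add v.2.choose_spec)
      map_smul' := fun c u => (c • u).2.choose_spec.unique (u.2.choose_spec.smul c) }

theorem generatorRel_generator (E : DirichletForm m) (u : E.generator.domain) :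
    E.GeneratorRel (u : Lp ℝ 2 m) (E.generator u) :=
  u.2.choose_spec

end General

section Topological

variable {X : Type*} [TopologicalSpace X] [MeasurableSpace X] [BorelSpace X] {m : Measure X}
  [IsFiniteMeasureOnCompacts m]

/-- The class in `L²(X, m)` of a continuous compactly supported function. -/
noncomputable def toL2 (m : Measure X) [IsFiniteMeasureOnCompacts m] (f : C_c(X, ℝ)) :
    Lp ℝ 2 m :=
  (f.continuous.memLp_of_hasCompactSupport f.hasCompactSupport : MemLp (⇑f) 2 m).toLp f

/-- `f ∈ C_c(X) ∩ 𝒟(ℰ)`. -/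
def InDom (E : DirichletForm m) (f : C_c(X, ℝ)) : Prop := toL2 m f ∈ E.dom

/-- A core: a subset of `C_c(X) ∩ 𝒟(ℰ)` which is uniformly dense in `C_c(X)` and dense in `𝒟(ℰ)`
with respect to the norm of `ℰ₁`. -/
structure IsCore (E : DirichletForm m) (A : Set C_c(X, ℝ)) : Prop where
  inDom : ∀ f ∈ A, E.InDom f
  uniformly_dense : ∀ φ : C_c(X, ℝ), ∀ ε : ℝ, 0 < ε → ∃ f ∈ A, ∀ x, |f x - φ x| < ε
  dense : ∀ u : E.dom, ∀ ε : ℝ, 0 < ε →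
    ∃ f ∈ A, ∃ hf : E.InDom f, E.normSq (⟨toL2 m f, hf⟩ - u) < ε

/-- A Dirichlet form is regular if it has a core. -/
def IsRegular (E : DirichletForm m) : Prop := ∃ A : Set C_c(X, ℝ), E.IsCore A

/-- Strong locality: `ℰ(f, g) = 0` for all `f, g ∈ C_c(X) ∩ 𝒟(ℰ)` such that `g` is constant on a
neighborhood of the support of `f`. -/
def IsStronglyLocal (E : DirichletForm m) : Prop :=
  ∀ (f g : C_c(X, ℝ)) (hf : E.InDom f) (hg : E.InDom g),
    (∃ U : Set X, IsOpen U ∧ tsupport f ⊆ U ∧ ∃ c : ℝ, ∀ x ∈ U, g x = c) →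
    E.form ⟨toL2 m f, hf⟩ ⟨toL2 m g, hg⟩ = 0

/-- `γ ∈ L¹(X, m)` is an energy density of `f` and `g`:
`½ (ℰ(f h, g) + ℰ(g h, f) - ℰ(f g, h)) = ∫ h γ dm` for all `h ∈ C_c(X) ∩ 𝒟(ℰ)`. -/
def IsMutualDensity (E : DirichletForm m) (f g : C_c(X, ℝ)) (γ : Lp ℝ 1 m) : Prop :=
  ∀ h : C_c(X, ℝ), E.InDom h →
    (1 / 2 : ℝ) * (E.val (toL2 m (f * h)) (toL2 m g) + E.val (toL2 m (g * h)) (toL2 m f)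
      - E.val (toL2 m (f * g)) (toL2 m h)) = ∫ x, h x * γ x ∂m

/-- The form admits a carré du champ. -/
def AdmitsCarreDuChamp (E : DirichletForm m) : Prop :=
  ∀ f g : C_c(X, ℝ), E.InDom f → E.InDom g → ∃ γ : Lp ℝ 1 m, E.IsMutualDensity f g γ

open Classical in
/-- The carré du champ `Γ(f, g) ∈ L¹(X, m)` of `f, g ∈ C_c(X) ∩ 𝒟(ℰ)`; its defining identity
determines it uniquely when the form is regular and `m` is a finite measure. -/
noncomputable def carreDuChamp (E : DirichletForm m) (f g : C_c(X, ℝ)) : Lp ℝ 1 m :=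
  if h : ∃ γ : Lp ℝ 1 m, E.IsMutualDensity f g γ then h.choose else 0

/-- `γ = Γ(u)` for an arbitrary `u ∈ 𝒟(ℰ)`: the continuous extension of the quadratic map
`f ↦ Γ(f, f)` from `C_c(X) ∩ 𝒟(ℰ)` to `𝒟(ℰ)`, with values in `L¹(X, m)`. -/
def IsEnergyDensity (E : DirichletForm m) (u : E.dom) (γ : Lp ℝ 1 m) : Prop :=
  ∃ (f : ℕ → C_c(X, ℝ)) (hf : ∀ n, E.InDom (f n)),
    Tendsto (fun n => E.normSq (⟨toL2 m (f n), hf n⟩ - u)) atTop (𝓝 0) ∧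
    Tendsto (fun n => E.carreDuChamp (f n) (f n)) atTop (𝓝 γ)

/-- The standing assumption on the form and the algebra `A`. Regularity of the form is part of it,
through the core `A`. -/
structure StandingAssumption (E : DirichletForm m) (A : NonUnitalSubalgebra ℝ C_c(X, ℝ)) :
    Prop where
  stronglyLocal : E.IsStronglyLocal
  admitsCarreDuChamp : E.AdmitsCarreDuChamp
  core : E.IsCore (A : Set C_c(X, ℝ))
  bounded : ∀ f ∈ A, ∀ g ∈ A, MemLp (E.carreDuChamp f g) ∞ m

theorem StandingAssumption.isRegular {E : DirichletForm m} {A : NonUnitalSubalgebra ℝ C_c(X, ℝ)}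
    (h : E.StandingAssumption A) : E.IsRegular :=
  ⟨_, h.core⟩

/-- There is a linear space `V` of functions in the domain of the generator, dense in `𝒟(ℰ)`, such
that `Γ(u)` and `ℒ u` are in `L^∞(X, m)` for every `u ∈ V`. -/
def GeneratorAssumption (E : DirichletForm m) : Prop :=
  ∃ V : Submodule ℝ (Lp ℝ 2 m),
    V ≤ E.generator.domain ∧
    (∀ u : E.dom, ∀ ε : ℝ, 0 < ε →
      ∃ v : E.dom, (v : Lp ℝ 2 m) ∈ V ∧ E.normSq (v - u) < ε) ∧
    (∀ u : E.dom, (u : Lp ℝ 2 m) ∈ V →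
      ∃ γ : Lp ℝ 1 m, E.IsEnergyDensity u γ ∧ MemLp γ ∞ m) ∧
    (∀ u : E.generator.domain, (u : Lp ℝ 2 m) ∈ V → MemLp (E.generator u) ∞ m)

/-- The `p`-energy `ℰ^(p)(f) = ∫ Γ(f)^(p/2) dm`. -/
noncomputable def pEnergy (E : DirichletForm m) (p : ℝ) (f : C_c(X, ℝ)) : ℝ :=
  ∫ x, (E.carreDuChamp f f x) ^ (p / 2) ∂m

/-- `F` is a sequence in `A`, Cauchy in the seminorm `ℰ^(p)(·)^(1/p)`, and converges to `f` in
`L^p(X, m)`. -/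
structure Approximates (E : DirichletForm m) (A : NonUnitalSubalgebra ℝ C_c(X, ℝ)) (p : ℝ)
    (F : ℕ → C_c(X, ℝ)) (f : X → ℝ) : Prop where
  mem : ∀ n, F n ∈ A
  cauchy : ∀ ε : ℝ, 0 < ε → ∃ N : ℕ, ∀ n, N ≤ n → ∀ k, N ≤ k →
    E.pEnergy p (F n - F k) ^ (1 / p) < ε
  tendsto : Tendsto (fun n => eLpNorm (fun x => F n x - f x) (ENNReal.ofReal p) m) atTop (𝓝 0)

/-- `(ℰ^(p), A)` is closable in `L^p(X, m)`. -/
def IsPClosable (E : DirichletForm m) (A : NonUnitalSubalgebra ℝ C_c(X, ℝ)) (p : ℝ) : Prop :=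
  ∀ F : ℕ → C_c(X, ℝ), E.Approximates A p F (fun _ => 0) →
    Tendsto (fun n => E.pEnergy p (F n)) atTop (𝓝 0)

/-- The set of all `f ∈ L^p(X, m)` that are limits in `L^p(X, m)` of sequences in `A` which are
Cauchy in the seminorm `ℰ^(p)(·)^(1/p)`. -/
def sobolevSet (E : DirichletForm m) (A : NonUnitalSubalgebra ℝ C_c(X, ℝ)) (p : ℝ) :
    Set (Lp ℝ (ENNReal.ofReal p) m) :=
  {f | ∃ F : ℕ → C_c(X, ℝ), E.Approximates A p F f}

/-- `N` is a norm on the real vector space `V` and makes it a Banach space. -/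
structure IsBanachNorm {V : Type*} [AddCommGroup V] [Module ℝ V] (N : V → ℝ) : Prop where
  nonneg : ∀ v, 0 ≤ N v
  eq_zero_iff : ∀ v, N v = 0 ↔ v = 0
  smul : ∀ (c : ℝ) (v : V), N (c • v) = |c| * N v
  add_le : ∀ v w, N (v + w) ≤ N v + N w
  complete : ∀ u : ℕ → V,
    (∀ ε : ℝ, 0 < ε → ∃ M : ℕ, ∀ n, M ≤ n → ∀ k, M ≤ k → N (u n - u k) < ε) →
    ∃ v : V, Tendsto (fun n => N (u n - v)) atTop (𝓝 0)

/-- The Sobolev space `H_0^{1,p}(X, m)` is a well-defined Banach space: it is a vector space `H`, the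
number `Q f = lim ℰ^(p)(F n)` exists for `f ∈ H` and does not depend on the approximating
sequence `F`, and `H` is a Banach space with norm `‖f‖_{L^p} + (Q f)^(1/p)`. -/
def SobolevSpaceIsBanach (E : DirichletForm m) (A : NonUnitalSubalgebra ℝ C_c(X, ℝ)) (p : ℝ) :
    Prop :=
  ∃ (H : Submodule ℝ (Lp ℝ (ENNReal.ofReal p) m)) (Q : H → ℝ),
    (H : Set (Lp ℝ (ENNReal.ofReal p) m)) = E.sobolevSet A p ∧
    (∀ (f : H) (F : ℕ → C_c(X, ℝ)),
      E.Approximates A p F (f : Lp ℝ (ENNReal.ofReal p) m) →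
      Tendsto (fun n => E.pEnergy p (F n)) atTop (𝓝 (Q f))) ∧
    IsBanachNorm (fun f : H => ‖(f : Lp ℝ (ENNReal.ofReal p) m)‖ + Q f ^ (1 / p))

end Topological

end DirichletForm

/-!
Throughout, `C` denotes `C_c(X) ∩ 𝒟(ℰ)`, and `|∇u|` stands for `√Γ(u, u)`.

**Carré du champ.** The form is approximated by `ℰ^(β)(u, v) = β ⟨u - T_β u, v⟩` with the scaled
resolvent `T_β = β (β - ℒ)⁻¹` (`resolvent`, `approxForm`). It is Markovian since `T_β u` minimises
`ℰ(v, v) + β ‖v - u‖²` and the unit contraction does not increase this functional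
(`resolventL2_mem_unitInterval`). Two pointwise inequalities for Markovian operators then show that
`C` is an algebra (`InDom.mul`) and that `Γ(f, f) ≥ 0` for `f ∈ C` (`contGamma_self_nonneg`).
Strong locality excludes killing, so `∫ Γ(f, f) dm = ℰ(f, f)` (`integral_contGamma_self`). Hence `Γ`
extends to a continuous bilinear map `gamma` on the whole form domain, which satisfies the pointwise
Cauchy–Schwarz inequality; in particular `||∇u| - |∇v|| ≤ |∇(u - v)|` almost everywhere.

**Closability.** Let `f_n ∈ A` be Cauchy for the `p`-energy with `f_n → 0` in `L^p`. By the last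
inequality `|∇f_n|` converges in `L^p`, so it suffices to show that `|∇f_n| → 0` almost everywhere
along a subsequence (`tendsto_pSeminorm_of_subseq`). For `p ≥ 2` and finite `m` the sequence is
Cauchy in the Hilbert space `𝒟(ℰ)`, where its limit must be `0`, so `|∇f_n| → 0` in `L²`. Under the
assumption on the generator, let `u` be in the given subspace of its domain. Then
`∫ g Γ(f_n, u) dm = -∫ f_n (g ℒu + Γ(g, u)) dm → 0` for `g ∈ A`
(`integral_mul_gamma_add`, `tendsto_integral_mul_gamma`), and since `Γ(f_n, u)` converges in `L¹`,
its limit is `0`. A fast subsequence has pointwise Cauchy gradients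
(`exists_subseq_grad_cauchy`); along it `Γ(f_n, u) → 0` almost everywhere, first for these `u`, by
density for all `u ∈ 𝒟(ℰ)`, and finally for `u = f_k`, which forces `|∇f_n| → 0`
(`tendsto_grad_of_weak`). This plays the part of the density of the gradients of such `u` in the
fibres of a measurable field of Hilbert spaces.

**Banach space.** The completion of any closable seminorm inside a Banach space is a Banach space
with the graph norm (`SeminormClosable.isBanachNorm`).
-/

/-! ### The form domain as a Hilbert space -/

namespace DirichletForm

section FormDomain

variable {X : Type*} [MeasurableSpace X] {m : Measure X}

/-- The domain of a Dirichlet form, as a type synonym that carries the inner product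
`ℰ₁(u, v) = ℰ(u, v) + ⟨u, v⟩` in place of the one inherited from `L²(X, m)`. -/
def FormDomain (E : DirichletForm m) : Type _ := E.dom

noncomputable instance (E : DirichletForm m) : AddCommGroup E.FormDomain :=
  inferInstanceAs (AddCommGroup E.dom)

noncomputable instance (E : DirichletForm m) : Module ℝ E.FormDomain :=
  inferInstanceAs (Module ℝ E.dom)

/-- The form `ℰ` on the type synonym `FormDomain`. -/
noncomputable def energy (E : DirichletForm m) : E.FormDomain →ₗ[ℝ] E.FormDomain →ₗ[ℝ] ℝ := E.form

/-- The inclusion of the form domain into `L²(X, m)`, as a linear map. -/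
noncomputable def inclLinear (E : DirichletForm m) : E.FormDomain →ₗ[ℝ] Lp ℝ 2 m :=
  E.dom.subtype

theorem inclLinear_injective (E : DirichletForm m) : Function.Injective E.inclLinear :=
  E.dom.injective_subtype

theorem energy_symm (E : DirichletForm m) (u v : E.FormDomain) : E.energy u v = E.energy v u :=
  E.symm u v

theorem energy_nonneg (E : DirichletForm m) (u : E.FormDomain) : 0 ≤ E.energy u u :=
  E.nonneg u

/-- The inner product `ℰ₁` on the form domain. -/
noncomputable abbrev formDomainCore (E : DirichletForm m) :
    InnerProductSpace.Core ℝ E.FormDomain where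
  inner u v := E.energy u v + inner ℝ (E.inclLinear u) (E.inclLinear v)
  conj_inner_symm u v := by
    simp only [conj_trivial]
    rw [E.energy_symm, real_inner_comm]
  re_inner_nonneg u := by
    simp only [RCLike.re_to_real]
    exact add_nonneg (E.energy_nonneg u) real_inner_self_nonneg
  add_left u v w := by
    simp only [map_add, LinearMap.add_apply, inner_add_left]
    ring
  smul_left u v c := by
    simp only [map_smul, LinearMap.smul_apply, real_inner_smul_left, smul_eq_mul, conj_trivial]
    ring
  definite u h := by
    have h0 := E.energy_nonneg u
    have h1 : 0 ≤ inner ℝ (E.inclLinear u) (E.inclLinear u) := real_inner_self_nonneg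
    have h2 : inner ℝ (E.inclLinear u) (E.inclLinear u) = 0 := by linarith
    exact (map_eq_zero_iff _ E.inclLinear_injective).1 (inner_self_eq_zero.1 h2)

noncomputable instance (E : DirichletForm m) : NormedAddCommGroup E.FormDomain :=
  E.formDomainCore.toNormedAddCommGroup

noncomputable instance (E : DirichletForm m) : InnerProductSpace ℝ E.FormDomain :=
  InnerProductSpace.ofCore E.formDomainCore.toCore

theorem formDomain_norm_sq (E : DirichletForm m) (u : E.FormDomain) :
    ‖u‖ ^ 2 = E.energy u u + ‖E.inclLinear u‖ ^ 2 := by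
  rw [← real_inner_self_eq_norm_sq, ← real_inner_self_eq_norm_sq]
  rfl

theorem normSq_eq_formDomain_norm_sq (E : DirichletForm m) (u : E.dom) :
    E.normSq u = ‖(show E.FormDomain from u)‖ ^ 2 :=
  (E.formDomain_norm_sq u).symm

theorem energy_le_norm_sq (E : DirichletForm m) (u : E.FormDomain) : E.energy u u ≤ ‖u‖ ^ 2 := by
  rw [formDomain_norm_sq]
  linarith [sq_nonneg ‖E.inclLinear u‖]

/-- The inclusion of the form domain into `L²(X, m)`. -/
noncomputable def incl (E : DirichletForm m) : E.FormDomain →L[ℝ] Lp ℝ 2 m :=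
  E.inclLinear.mkContinuous 1 fun u => by
    rw [one_mul]
    refine le_of_sq_le_sq ?_ (norm_nonneg _)
    rw [formDomain_norm_sq]
    linarith [E.energy_nonneg u]

theorem incl_injective (E : DirichletForm m) : Function.Injective E.incl :=
  E.inclLinear_injective

theorem formDomain_inner (E : DirichletForm m) (u v : E.FormDomain) :
    inner ℝ u v = E.energy u v + inner ℝ (E.incl u) (E.incl v) := rfl

theorem formDomain_norm_sq' (E : DirichletForm m) (u : E.FormDomain) :
    ‖u‖ ^ 2 = E.energy u u + ‖E.incl u‖ ^ 2 := E.formDomain_norm_sq u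

theorem energy_sub_self (E : DirichletForm m) (u v : E.FormDomain) :
    E.energy (u - v) (u - v) = E.energy u u - 2 * E.energy u v + E.energy v v := by
  simp only [map_sub, LinearMap.sub_apply]
  rw [E.energy_symm v u]
  ring

theorem continuous_energy_left (E : DirichletForm m) (v : E.FormDomain) :
    Continuous fun u => E.energy u v := by
  have : (fun u => E.energy u v) = fun u => inner ℝ u v - inner ℝ (E.incl u) (E.incl v) := by
    ext u
    rw [formDomain_inner]
    ring
  rw [this]
  fun_prop

instance (E : DirichletForm m) : CompleteSpace E.FormDomain := by
  refine Metric.complete_of_cauchySeq_tendsto fun u hu => ?_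
  obtain ⟨v, hv⟩ := E.closed u fun ε hε => by
    obtain ⟨N, hN⟩ := Metric.cauchySeq_iff.1 hu (Real.sqrt ε) (Real.sqrt_pos.2 hε)
    refine ⟨N, fun n hn k hk => ?_⟩
    have h1 := hN n hn k hk
    rw [dist_eq_norm] at h1
    have h2 := (Real.lt_sqrt (norm_nonneg _)).1 h1
    rw [formDomain_norm_sq] at h2
    exact h2
  let v' : E.FormDomain := v
  refine ⟨v', tendsto_iff_norm_sub_tendsto_zero.2 ?_⟩
  have h2 : Tendsto (fun n => ‖u n - v'‖ ^ 2) atTop (𝓝 0) := by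
    refine hv.congr fun n => ?_
    rw [formDomain_norm_sq]
    rfl
  have := h2.sqrt
  simpa [Real.sqrt_sq (norm_nonneg _)] using this

/-! ### The resolvent and the approximating forms -/

/-- The bounded bilinear form `ℰ(u, v) + (n + 1) ⟨u, v⟩` on the form domain. -/
noncomputable def shiftedForm (E : DirichletForm m) (n : ℕ) :
    E.FormDomain →L[ℝ] E.FormDomain →L[ℝ] ℝ :=
  innerSL ℝ + (n : ℝ) • (innerSL ℝ).bilinearComp E.incl E.incl

theorem shiftedForm_apply (E : DirichletForm m) (n : ℕ) (u v : E.FormDomain) :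
    E.shiftedForm n u v = E.energy u v + (n + 1) * inner ℝ (E.incl u) (E.incl v) := by
  have : E.shiftedForm n u v = inner ℝ u v + n * inner ℝ (E.incl u) (E.incl v) := rfl
  rw [this, formDomain_inner]
  ring

theorem isCoercive_shiftedForm (E : DirichletForm m) (n : ℕ) : IsCoercive (E.shiftedForm n) := by
  refine ⟨1, one_pos, fun u => ?_⟩
  rw [shiftedForm_apply, real_inner_self_eq_norm_sq, one_mul, ← sq, formDomain_norm_sq']
  have : 0 ≤ (n : ℝ) * ‖E.incl u‖ ^ 2 := by positivity
  linarith

/-- The scaled resolvent `β (β - ℒ)⁻¹` with `β = n + 1`, as a map into the form domain. -/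
noncomputable def resolvent (E : DirichletForm m) (n : ℕ) : Lp ℝ 2 m →ₗ[ℝ] E.FormDomain :=
  (n + 1 : ℝ) •
    ((E.isCoercive_shiftedForm n).continuousLinearEquivOfBilin.symm.toContinuousLinearMap.comp
      (ContinuousLinearMap.adjoint E.incl)).toLinearMap

theorem shiftedForm_resolvent (E : DirichletForm m) (n : ℕ) (w : Lp ℝ 2 m) (g : E.FormDomain) :
    E.energy (E.resolvent n w) g + (n + 1) * inner ℝ (E.incl (E.resolvent n w)) (E.incl g)
      = (n + 1) * inner ℝ w (E.incl g) := by
  rw [← shiftedForm_apply, ← IsCoercive.continuousLinearEquivOfBilin_apply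
    (E.isCoercive_shiftedForm n)]
  simp only [resolvent, LinearMap.smul_apply, map_smul, ContinuousLinearMap.coe_coe,
    ContinuousLinearMap.comp_apply, ContinuousLinearEquiv.coe_coe,
    ContinuousLinearEquiv.apply_symm_apply, real_inner_smul_left,
    ContinuousLinearMap.adjoint_inner_left]

theorem energy_resolvent (E : DirichletForm m) (n : ℕ) (w : Lp ℝ 2 m) (g : E.FormDomain) :
    E.energy (E.resolvent n w) g
      = (n + 1) * inner ℝ (w - E.incl (E.resolvent n w)) (E.incl g) := by
  have := E.shiftedForm_resolvent n w g
  rw [inner_sub_left]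
  linarith

/-- The operator `β (β - ℒ)⁻¹` on `L²(X, m)` with `β = n + 1`. -/
noncomputable def resolventL2 (E : DirichletForm m) (n : ℕ) : Lp ℝ 2 m →ₗ[ℝ] Lp ℝ 2 m :=
  E.incl.toLinearMap ∘ₗ E.resolvent n

theorem resolventL2_apply (E : DirichletForm m) (n : ℕ) (w : Lp ℝ 2 m) :
    E.resolventL2 n w = E.incl (E.resolvent n w) := rfl

theorem inner_resolventL2 (E : DirichletForm m) (n : ℕ) (v w : Lp ℝ 2 m) :
    inner ℝ (E.resolventL2 n v) w = inner ℝ v (E.resolventL2 n w) := by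
  have h1 := E.shiftedForm_resolvent n v (E.resolvent n w)
  have h2 := E.shiftedForm_resolvent n w (E.resolvent n v)
  rw [E.energy_symm, real_inner_comm] at h2
  have h3 : ((n : ℝ) + 1) * inner ℝ v (E.incl (E.resolvent n w))
      = (n + 1) * inner ℝ w (E.incl (E.resolvent n v)) := by rw [← h1, ← h2]
  have h4 := mul_left_cancel₀ (by positivity : (n : ℝ) + 1 ≠ 0) h3
  rw [resolventL2_apply, resolventL2_apply, h4, real_inner_comm]

/-- The approximating form `ℰ^(β)(u, v) = β ⟨u - β (β - ℒ)⁻¹ u, v⟩` with `β = n + 1`, which is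
defined on all of `L²(X, m)`. -/
noncomputable def approxForm (E : DirichletForm m) (n : ℕ) (u v : Lp ℝ 2 m) : ℝ :=
  (n + 1) * inner ℝ (u - E.resolventL2 n u) v

theorem approxForm_incl_right (E : DirichletForm m) (n : ℕ) (u : Lp ℝ 2 m) (v : E.FormDomain) :
    E.approxForm n u (E.incl v) = E.energy (E.resolvent n u) v :=
  (E.energy_resolvent n u v).symm

theorem approxForm_self (E : DirichletForm m) (n : ℕ) (w : Lp ℝ 2 m) :
    E.approxForm n w w = E.energy (E.resolvent n w) (E.resolvent n w)
      + (n + 1) * ‖w - E.resolventL2 n w‖ ^ 2 := by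
  rw [energy_resolvent, ← real_inner_self_eq_norm_sq, approxForm, ← mul_add, ← resolventL2_apply,
    ← inner_add_right, add_sub_cancel]

theorem approxForm_incl_le (E : DirichletForm m) (n : ℕ) (u : E.FormDomain) :
    E.approxForm n (E.incl u) (E.incl u) ≤ E.energy u u := by
  have h1 := E.approxForm_self n (E.incl u)
  have h2 := E.approxForm_incl_right n (E.incl u) u
  have h3 := E.energy_nonneg (u - E.resolvent n (E.incl u))
  rw [energy_sub_self, E.energy_symm u (E.resolvent n _)] at h3
  have h4 : 0 ≤ ((n : ℝ) + 1) * ‖E.incl u - E.resolventL2 n (E.incl u)‖ ^ 2 := by positivity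
  linarith

/-- The energies `ℰ(β (β - ℒ)⁻¹ w)` increase with `β`, and their increments control the energy of
the increments. -/
theorem energy_resolvent_sub_le (E : DirichletForm m) {n k : ℕ} (h : n ≤ k) (w : Lp ℝ 2 m) :
    E.energy (E.resolvent k w - E.resolvent n w) (E.resolvent k w - E.resolvent n w)
      ≤ E.energy (E.resolvent k w) (E.resolvent k w)
        - E.energy (E.resolvent n w) (E.resolvent n w) := by
  rcases h.eq_or_lt with rfl | h
  · simp
  set z := E.resolvent k w - E.resolvent n w with hz
  have h1 := E.shiftedForm_resolvent k w z
  have h2 := E.energy_resolvent n w z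
  have h3 : E.energy z z = E.energy (E.resolvent k w) z - E.energy (E.resolvent n w) z := by
    rw [← LinearMap.sub_apply, ← map_sub]
  have h4 : ‖E.incl z‖ ^ 2 = inner ℝ (E.incl (E.resolvent k w)) (E.incl z)
      - inner ℝ (E.incl (E.resolvent n w)) (E.incl z) := by
    rw [← inner_sub_left, ← map_sub, ← real_inner_self_eq_norm_sq]
  rw [inner_sub_left] at h2
  have h5 : E.energy z z + (k + 1) * ‖E.incl z‖ ^ 2 = ((k : ℝ) - n)
      * inner ℝ (w - E.incl (E.resolvent n w)) (E.incl z) := by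
    rw [inner_sub_left, h3, h4]
    linear_combination h1 - h2
  have hkn : (0 : ℝ) < k - n := sub_pos.2 (by exact_mod_cast h)
  have h6 : 0 ≤ inner ℝ (w - E.incl (E.resolvent n w)) (E.incl z) := by
    refine nonneg_of_mul_nonneg_right (a := (k : ℝ) - n) ?_ hkn
    rw [← h5]
    have := E.energy_nonneg z
    positivity
  have h7 : 0 ≤ E.energy (E.resolvent n w) z := by
    rw [energy_resolvent]
    positivity
  have h8 : E.energy (E.resolvent n w) z
      = E.energy (E.resolvent n w) (E.resolvent k w)
        - E.energy (E.resolvent n w) (E.resolvent n w) := by rw [hz, map_sub]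
  rw [hz, energy_sub_self, E.energy_symm _ (E.resolvent n w)]
  linarith

/-- A function with bounded approximating energies lies in the form domain, and its resolvent
approximations converge to it there. -/
theorem exists_incl_eq_of_approxForm_le (E : DirichletForm m) {w : Lp ℝ 2 m} {C : ℝ}
    (hC : ∀ n, E.approxForm n w w ≤ C) :
    ∃ u : E.FormDomain, E.incl u = w ∧ Tendsto (fun n => E.resolvent n w) atTop (𝓝 u) := by
  have hL2 : Tendsto (fun n => E.incl (E.resolvent n w)) atTop (𝓝 w) := by
    rw [tendsto_iff_norm_sub_tendsto_zero]
    have h1 : ∀ n : ℕ, ‖E.incl (E.resolvent n w) - w‖ ^ 2 ≤ C * (1 / ((n : ℝ) + 1)) := by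
      intro n
      have h2 := E.approxForm_self n w
      have h3 := E.energy_nonneg (E.resolvent n w)
      have h4 : (0 : ℝ) < n + 1 := by positivity
      rw [mul_one_div, le_div_iff₀ h4, norm_sub_rev, ← resolventL2_apply]
      linarith [hC n]
    have h5 : Tendsto (fun n => ‖E.incl (E.resolvent n w) - w‖ ^ 2) atTop (𝓝 0) :=
      squeeze_zero (fun n => sq_nonneg _) h1
        (by simpa using (tendsto_one_div_add_atTop_nhds_zero_nat (𝕜 := ℝ)).const_mul C)
    simpa [Real.sqrt_sq (norm_nonneg _)] using h5.sqrt
  set e : ℕ → ℝ := fun n => E.energy (E.resolvent n w) (E.resolvent n w) with he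
  have hmono : Monotone e := fun n k h => by
    have h1 := E.energy_resolvent_sub_le h w
    have h2 := E.energy_nonneg (E.resolvent k w - E.resolvent n w)
    simp only [he]
    linarith
  have hbdd : BddAbove (Set.range e) := by
    refine ⟨C, ?_⟩
    rintro _ ⟨n, rfl⟩
    have h2 := E.approxForm_self n w
    have : 0 ≤ ((n : ℝ) + 1) * ‖w - E.resolventL2 n w‖ ^ 2 := by positivity
    simp only [he]
    linarith [hC n]
  have hecau : CauchySeq e := (tendsto_atTop_ciSup hmono hbdd).cauchySeq
  have hcau : CauchySeq fun n => E.resolvent n w := by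
    rw [Metric.cauchySeq_iff']
    intro ε hε
    obtain ⟨N1, hN1⟩ := Metric.cauchySeq_iff.1 hecau (ε ^ 2 / 2) (by positivity)
    obtain ⟨N2, hN2⟩ := Metric.cauchySeq_iff.1 hL2.cauchySeq (ε / 2) (by positivity)
    refine ⟨max N1 N2, fun n hn => ?_⟩
    have h1 := hN1 n ((le_max_left _ _).trans hn) (max N1 N2) (le_max_left _ _)
    have h2 := hN2 n ((le_max_right _ _).trans hn) (max N1 N2) (le_max_right _ _)
    have h3 := E.energy_resolvent_sub_le hn w
    rw [Real.dist_eq, abs_lt] at h1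
    rw [dist_eq_norm, ← map_sub] at h2
    rw [dist_eq_norm]
    refine lt_of_pow_lt_pow_left₀ 2 hε.le ?_
    rw [formDomain_norm_sq']
    have h4 : ‖E.incl (E.resolvent n w - E.resolvent (max N1 N2) w)‖ ^ 2 < (ε / 2) ^ 2 :=
      pow_lt_pow_left₀ h2 (norm_nonneg _) two_ne_zero
    simp only [he] at h1
    nlinarith [sq_nonneg ε]
  obtain ⟨u, hu⟩ := cauchySeq_tendsto_of_complete hcau
  exact ⟨u, tendsto_nhds_unique ((E.incl.continuous.tendsto u).comp hu) hL2, hu⟩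

theorem tendsto_approxForm (E : DirichletForm m) (u v : E.FormDomain) :
    Tendsto (fun n => E.approxForm n (E.incl u) (E.incl v)) atTop (𝓝 (E.energy u v)) := by
  obtain ⟨u', hu', h⟩ := E.exists_incl_eq_of_approxForm_le (w := E.incl u)
    fun n => E.approxForm_incl_le n u
  rw [E.incl_injective hu'] at h
  simp only [approxForm_incl_right]
  exact ((E.continuous_energy_left v).tendsto u).comp h

end FormDomain

end DirichletForm

/-! ### Markov property of the resolvent -/

namespace DirichletForm

section Markov

variable {X : Type*} [MeasurableSpace X] {m : Measure X}

theorem coeFn_unitContraction (u : Lp ℝ 2 m) :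
    unitContraction u =ᵐ[m] fun x => min (max 0 (u x)) 1 :=
  lipschitzWith_unitCut.coeFn_compLp (by simp) u

/-- The resolvent preserves functions with values in `[0, 1]`: `β (β - ℒ)⁻¹ u` is the unique
minimiser of `ℰ(v, v) + β ‖v - u‖²`, and the unit contraction does not increase this functional. -/
theorem resolventL2_mem_unitInterval (E : DirichletForm m) (n : ℕ) {u : Lp ℝ 2 m}
    (h0 : ∀ᵐ x ∂m, 0 ≤ u x) (h1 : ∀ᵐ x ∂m, u x ≤ 1) :
    ∀ᵐ x ∂m, 0 ≤ E.resolventL2 n u x ∧ E.resolventL2 n u x ≤ 1 := by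
  obtain ⟨hmem, hle⟩ := E.markov (E.resolvent n u)
  let r : E.FormDomain := E.resolvent n u
  let r' : E.FormDomain := ⟨_, hmem⟩
  have hle' : E.energy r' r' ≤ E.energy r r := hle
  have hincl : E.incl r' = unitContraction (E.incl r) := rfl
  have hnorm : ‖E.incl r' - u‖ ≤ ‖E.incl r - u‖ := by
    refine Lp.norm_le_norm_of_ae_le ?_
    filter_upwards [h0, h1, Lp.coeFn_sub (E.incl r') u, Lp.coeFn_sub (E.incl r) u,
      coeFn_unitContraction (E.incl r)] with x hx0 hx1 hx2 hx3 hx4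
    rw [hx2, hx3, Pi.sub_apply, Pi.sub_apply, hincl, hx4]
    have h := lipschitzWith_unitCut.dist_le_mul (E.incl r x) (u x)
    simp only [NNReal.coe_one, one_mul, Real.dist_eq] at h
    rwa [max_eq_right hx0, min_eq_left hx1] at h
  have hz : r' = r := by
    set z := r' - r with hz
    have e1 : E.energy r' r' = E.energy r r + 2 * E.energy r z + E.energy z z := by
      have : r' = r + z := by simp [hz]
      rw [this]
      simp only [map_add, LinearMap.add_apply]
      rw [E.energy_symm z r]
      ring
    have e2 : ‖E.incl r' - u‖ ^ 2 = ‖E.incl r - u‖ ^ 2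
        + 2 * inner ℝ (E.incl r - u) (E.incl z) + ‖E.incl z‖ ^ 2 := by
      rw [← norm_add_sq_real, hz, map_sub]
      congr 2
      abel
    have e3 := E.energy_resolvent n u z
    have e4 : inner ℝ (E.incl r - u) (E.incl z) = - inner ℝ (u - E.incl (E.resolvent n u))
        (E.incl z) := by rw [← inner_neg_left, neg_sub]
    have e5 : ‖E.incl r' - u‖ ^ 2 ≤ ‖E.incl r - u‖ ^ 2 :=
      pow_le_pow_left₀ (norm_nonneg _) hnorm 2
    have e6 := E.energy_nonneg z
    have e7 : (0 : ℝ) < n + 1 := by positivity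
    have e8 : ((n : ℝ) + 1) * ‖E.incl z‖ ^ 2 ≤ 0 := by
      have h3 : E.energy r z = (n + 1) * inner ℝ (u - E.incl (E.resolvent n u)) (E.incl z) := e3
      have h5 := mul_le_mul_of_nonneg_left e5 e7.le
      rw [e2, e4] at h5
      linarith
    have e9 : ‖E.incl z‖ ^ 2 ≤ 0 := nonpos_of_mul_nonpos_right e8 e7
    have e10 : E.incl z = 0 := by
      rw [← norm_eq_zero]
      exact pow_eq_zero_iff two_ne_zero |>.1 (le_antisymm e9 (sq_nonneg _))
    exact sub_eq_zero.1 ((map_eq_zero_iff _ E.incl_injective).1 e10)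
  have : E.resolventL2 n u = unitContraction (E.incl r) := by
    rw [← hincl, hz]
    rfl
  rw [this]
  filter_upwards [coeFn_unitContraction (E.incl r)] with x hx
  rw [hx]
  exact ⟨le_min (le_max_left _ _) zero_le_one, min_le_right _ _⟩

theorem resolventL2_nonneg (E : DirichletForm m) (n : ℕ) {u : Lp ℝ 2 m} {M : ℝ}
    (h0 : ∀ᵐ x ∂m, 0 ≤ u x) (h1 : ∀ᵐ x ∂m, u x ≤ M) :
    ∀ᵐ x ∂m, 0 ≤ E.resolventL2 n u x := by
  have hM : 0 < max M 1 := lt_max_of_lt_right one_pos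
  have h2 := E.resolventL2_mem_unitInterval n (u := (max M 1)⁻¹ • u)
    (by
      filter_upwards [h0, Lp.coeFn_smul (max M 1)⁻¹ u] with x hx hx2
      rw [hx2, Pi.smul_apply, smul_eq_mul]
      positivity)
    (by
      filter_upwards [h1, Lp.coeFn_smul (max M 1)⁻¹ u] with x hx hx2
      rw [hx2, Pi.smul_apply, smul_eq_mul, inv_mul_le_one₀ hM]
      exact hx.trans (le_max_left _ _))
  rw [map_smul] at h2
  filter_upwards [h2, Lp.coeFn_smul (max M 1)⁻¹ (E.resolventL2 n u)] with x hx hx2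
  rw [hx2, Pi.smul_apply, smul_eq_mul] at hx
  exact nonneg_of_mul_nonneg_right hx.1 (inv_pos.2 hM)

/-- A pointwise inequality `∑ cᵢ(a) vᵢ(y) ≥ 0`, valid for all `a`, is preserved when the resolvent
acts in the variable `y` and `a = f(x)` is inserted afterwards. This replaces an integral kernel of
the resolvent. -/
theorem sum_mul_resolventL2_nonneg (E : DirichletForm m) (n : ℕ) {k : ℕ} (c : Fin k → ℝ → ℝ)
    (hc : ∀ i, Continuous (c i)) (v : Fin k → Lp ℝ 2 m)
    (hv : ∀ i, ∃ M : ℝ, ∀ᵐ x ∂m, |v i x| ≤ M)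
    (h : ∀ a : ℝ, ∀ᵐ x ∂m, 0 ≤ ∑ i, c i a * v i x) (f : X → ℝ) :
    ∀ᵐ x ∂m, 0 ≤ ∑ i, c i (f x) * E.resolventL2 n (v i) x := by
  choose M hM using hv
  have coe : ∀ (a : ℝ) (w : Fin k → Lp ℝ 2 m),
      (∑ i, c i a • w i : Lp ℝ 2 m) =ᵐ[m] fun x => ∑ i, c i a * w i x := by
    intro a w
    have h1 : ∀ᵐ x ∂m, ∀ i, (c i a • w i : Lp ℝ 2 m) x = c i a * w i x := by
      rw [ae_all_iff]
      intro i
      filter_upwards [Lp.coeFn_smul (c i a) (w i)] with x hx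
      rw [hx, Pi.smul_apply, smul_eq_mul]
    filter_upwards [h1, Lp.coeFn_finsetSum Finset.univ fun i => c i a • w i] with x hx1 hx2
    rw [hx2, Finset.sum_apply]
    exact Finset.sum_congr rfl fun i _ => hx1 i
  have key : ∀ᵐ x ∂m, ∀ q : ℚ, 0 ≤ ∑ i, c i (q : ℝ) * E.resolventL2 n (v i) x := by
    rw [ae_all_iff]
    intro q
    have h2 := E.resolventL2_nonneg n (u := ∑ i, c i (q : ℝ) • v i)
      (M := ∑ i, |c i (q : ℝ)| * M i)
      (by
        filter_upwards [h q, coe q v] with x hx hx2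
        rwa [hx2])
      (by
        have h3 : ∀ᵐ x ∂m, ∀ i, |v i x| ≤ M i := ae_all_iff.2 hM
        filter_upwards [h3, coe q v] with x hx hx2
        rw [hx2]
        refine Finset.sum_le_sum fun i _ => (le_abs_self _).trans ?_
        rw [abs_mul]
        exact mul_le_mul_of_nonneg_left (hx i) (abs_nonneg _))
    simp only [map_sum, map_smul] at h2
    filter_upwards [h2, coe q fun i => E.resolventL2 n (v i)] with x hx hx2
    rwa [hx2] at hx
  filter_upwards [key] with x hx
  have hcont : Continuous fun a : ℝ => ∑ i, c i a * E.resolventL2 n (v i) x :=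
    continuous_finsetSum _ fun i _ => (hc i).mul continuous_const
  exact Rat.isDenseEmbedding_coe_real.dense.induction (P := fun a =>
    0 ≤ ∑ i, c i a * E.resolventL2 n (v i) x)
    (by rintro _ ⟨q, rfl⟩; exact hx q) (isClosed_le continuous_const hcont) (f x)

theorem inner_eq_integral (u v : Lp ℝ 2 m) : inner ℝ u v = ∫ x, u x * v x ∂m := by
  rw [L2.inner_def]
  refine integral_congr_ae (Eventually.of_forall fun x => ?_)
  simp [mul_comm]

theorem integrable_mul_Lp_two (u v : Lp ℝ 2 m) : Integrable (fun x => u x * v x) m :=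
  (Lp.memLp u).integrable_mul (Lp.memLp v)

theorem sum_mul_inner_nonneg {k : ℕ} (c : Fin k → ℝ) (u v : Fin k → Lp ℝ 2 m)
    (h : ∀ᵐ x ∂m, 0 ≤ ∑ i, c i * (u i x * v i x)) : 0 ≤ ∑ i, c i * inner ℝ (u i) (v i) := by
  simp only [inner_eq_integral, ← integral_const_mul]
  rw [← integral_finsetSum _ fun i _ => (integrable_mul_Lp_two _ _).const_mul _]
  exact integral_nonneg_of_ae h

/-- The constant function `1` as an element of `L²(X, m)`. -/
noncomputable def oneL2 (m : Measure X) [IsFiniteMeasure m] : Lp ℝ 2 m :=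
  (memLp_const (1 : ℝ)).toLp _

theorem coeFn_oneL2 [IsFiniteMeasure m] : oneL2 m =ᵐ[m] fun _ => (1 : ℝ) := MemLp.coeFn_toLp _

theorem resolventL2_one_le [IsFiniteMeasure m] (E : DirichletForm m) (n : ℕ) :
    ∀ᵐ x ∂m, E.resolventL2 n (oneL2 m) x ≤ 1 := by
  have := E.resolventL2_mem_unitInterval n (u := oneL2 m)
    (by filter_upwards [coeFn_oneL2 (m := m)] with x hx; rw [hx]; exact zero_le_one)
    (by filter_upwards [coeFn_oneL2 (m := m)] with x hx; rw [hx])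
  filter_upwards [this] with x hx
  exact hx.2

end Markov

section ContinuousFunctions

theorem exists_abs_le {X : Type*} [TopologicalSpace X] (f : C_c(X, ℝ)) : ∃ M : ℝ, ∀ x, |f x| ≤ M :=
  f.hasCompactSupport.exists_bound_of_continuous f.continuous

variable {X : Type*} [TopologicalSpace X] [MeasurableSpace X] [BorelSpace X] {m : Measure X}
  [IsFiniteMeasure m]

theorem coeFn_toL2 (f : C_c(X, ℝ)) : toL2 m f =ᵐ[m] f := MemLp.coeFn_toLp _

theorem exists_ae_abs_toL2_le (f : C_c(X, ℝ)) : ∃ M : ℝ, ∀ᵐ x ∂m, |toL2 m f x| ≤ M := by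
  obtain ⟨M, hM⟩ := exists_abs_le f
  refine ⟨M, ?_⟩
  filter_upwards [coeFn_toL2 (m := m) f] with x hx
  rw [hx]
  exact hM x

/-- The positivity of the energy densities of the approximating forms. -/
theorem approxForm_density_nonneg (E : DirichletForm m) (n : ℕ) (f h : C_c(X, ℝ))
    (hh : ∀ x, 0 ≤ h x) :
    0 ≤ E.approxForm n (toL2 m (f * h)) (toL2 m f)
      - 1 / 2 * E.approxForm n (toL2 m (f * f)) (toL2 m h) := by
  have key := E.sum_mul_resolventL2_nonneg n
    ![fun a => a ^ 2, fun a => -2 * a, fun _ => 1]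
    (by intro i; fin_cases i <;> simp <;> fun_prop)
    ![oneL2 m, toL2 m f, toL2 m (f * f)]
    (by
      intro i
      fin_cases i
      · refine ⟨1, ?_⟩
        filter_upwards [coeFn_oneL2 (m := m)] with x hx
        simp [hx]
      · exact exists_ae_abs_toL2_le f
      · exact exists_ae_abs_toL2_le (f * f))
    (by
      intro a
      filter_upwards [coeFn_oneL2 (m := m), coeFn_toL2 (m := m) f, coeFn_toL2 (m := m) (f * f)]
        with x h1 h2 h3
      simp only [Fin.sum_univ_three, Matrix.cons_val_zero, Matrix.cons_val_one, Matrix.cons_val, h1,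
        h2, h3, CompactlySupportedContinuousMap.coe_mul, Pi.mul_apply]
      nlinarith [sq_nonneg (a - f x)])
    f
  simp only [Fin.sum_univ_three, Matrix.cons_val_zero, Matrix.cons_val_one, Matrix.cons_val] at key
  have key2 := sum_mul_inner_nonneg (m := m) ![1, -1, -1 / 2, 1 / 2]
    ![toL2 m (f * h), toL2 m (f * h), toL2 m (f * f), E.resolventL2 n (toL2 m (f * f))]
    ![toL2 m f, E.resolventL2 n (toL2 m f), toL2 m h, toL2 m h] ?_
  · simp only [Fin.sum_univ_four, Matrix.cons_val_zero, Matrix.cons_val_one, Matrix.cons_val]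
      at key2
    rw [approxForm, approxForm, inner_sub_left, inner_sub_left, inner_resolventL2]
    have h1 := mul_nonneg (by positivity : (0 : ℝ) ≤ n + 1) key2
    linarith
  filter_upwards [key, E.resolventL2_one_le n, coeFn_toL2 (m := m) f, coeFn_toL2 (m := m) h,
    coeFn_toL2 (m := m) (f * f), coeFn_toL2 (m := m) (f * h)] with x h1 h2 h3 h4 h5 h6
  simp only [Fin.sum_univ_four, Matrix.cons_val_zero, Matrix.cons_val_one, Matrix.cons_val, h3, h4,
    h5, h6, CompactlySupportedContinuousMap.coe_mul, Pi.mul_apply]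
  have h7 : 0 ≤ h x * (f x ^ 2 - 2 * f x * E.resolventL2 n (toL2 m f) x
      + E.resolventL2 n (toL2 m (f * f)) x) := by
    refine mul_nonneg (hh x) ?_
    nlinarith [sq_nonneg (f x)]
  linarith

/-- The contraction property for `u ↦ u²`, from `(a² - b²)² ≤ 4 M² (a - b)²` for
`|a|, |b| ≤ M`. -/
theorem approxForm_mul_self_le (E : DirichletForm m) (n : ℕ) (f : C_c(X, ℝ)) {M : ℝ}
    (hM0 : 0 ≤ M) (hM : ∀ x, |f x| ≤ M) :
    E.approxForm n (toL2 m (f * f)) (toL2 m (f * f))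
      ≤ 4 * M ^ 2 * E.approxForm n (toL2 m f) (toL2 m f) := by
  set cl : ℝ → ℝ := fun a => max (-M) (min a M) with hcl
  have hclc : Continuous cl := by fun_prop
  have hclf : ∀ x, cl (f x) = f x := fun x => by
    have := abs_le.1 (hM x)
    simp only [hcl]
    rw [min_eq_left this.2, max_eq_right this.1]
  have hclb : ∀ a, |cl a| ≤ M := fun a => by
    rw [abs_le]
    exact ⟨le_max_left _ _, max_le (by linarith) (min_le_right _ _)⟩
  obtain ⟨g, hg⟩ : ∃ g, g = f * f := ⟨_, rfl⟩
  have hgx : ∀ x, g x = f x * f x := fun x => by rw [hg]; rfl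
  have hggx : ∀ x, (g * g) x = f x * f x * (f x * f x) := fun x => by
    rw [← hgx]; rfl
  rw [← hg]
  have key := E.sum_mul_resolventL2_nonneg n
    ![fun a => 4 * M ^ 2 * cl a ^ 2 - cl a ^ 4, fun a => -(8 * M ^ 2) * cl a,
      fun a => 4 * M ^ 2 + 2 * cl a ^ 2, fun _ => -1]
    (by intro i; fin_cases i <;> simp <;> fun_prop)
    ![oneL2 m, toL2 m f, toL2 m g, toL2 m (g * g)]
    (by
      intro i
      fin_cases i
      · refine ⟨1, ?_⟩
        filter_upwards [coeFn_oneL2 (m := m)] with x hx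
        simp [hx]
      · exact exists_ae_abs_toL2_le f
      · exact exists_ae_abs_toL2_le g
      · exact exists_ae_abs_toL2_le (g * g))
    (by
      intro a
      filter_upwards [coeFn_oneL2 (m := m), coeFn_toL2 (m := m) f, coeFn_toL2 (m := m) g,
        coeFn_toL2 (m := m) (g * g)] with x h1 h2 h3 h4
      simp only [Fin.sum_univ_four, Matrix.cons_val_zero, Matrix.cons_val_one, Matrix.cons_val, h1,
        h2, h3, h4, hgx, hggx]
      have hs : |cl a + f x| ≤ 2 * M :=
        (abs_add_le _ _).trans (by linarith [hclb a, hM x])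
      have hs2 : (cl a + f x) ^ 2 ≤ (2 * M) ^ 2 := sq_le_sq' (abs_le.1 hs).1 (abs_le.1 hs).2
      have := mul_nonneg (sq_nonneg (cl a - f x)) (sub_nonneg.2 hs2)
      linarith)
    f
  simp only [Fin.sum_univ_four, Matrix.cons_val_zero, Matrix.cons_val_one, Matrix.cons_val, hclf]
    at key
  set T := E.resolventL2 n with hT
  have i1 := sum_mul_inner_nonneg (m := m) ![4 * M ^ 2, -1, -(8 * M ^ 2), 4 * M ^ 2, 2, -1]
    ![toL2 m g, toL2 m (g * g), toL2 m f, oneL2 m, toL2 m g, oneL2 m]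
    ![T (oneL2 m), T (oneL2 m), T (toL2 m f), T (toL2 m g), T (toL2 m g), T (toL2 m (g * g))]
    (by
      filter_upwards [key, coeFn_oneL2 (m := m), coeFn_toL2 (m := m) f, coeFn_toL2 (m := m) g,
        coeFn_toL2 (m := m) (g * g)] with x h0 h1 h2 h3 h4
      simp only [Fin.sum_univ_six, Matrix.cons_val_zero, Matrix.cons_val_one, Matrix.cons_val,
        h1, h2, h3, h4, hgx, hggx]
      linarith)
  have i2 := sum_mul_inner_nonneg (m := m) ![4 * M ^ 2, -(4 * M ^ 2), -1, 1]
    ![toL2 m f, toL2 m g, toL2 m g, toL2 m (g * g)]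
    ![toL2 m f, T (oneL2 m), toL2 m g, T (oneL2 m)]
    (by
      filter_upwards [E.resolventL2_one_le n, coeFn_toL2 (m := m) f, coeFn_toL2 (m := m) g,
        coeFn_toL2 (m := m) (g * g)] with x h1 h2 h3 h4
      simp only [Fin.sum_univ_four, Matrix.cons_val_zero, Matrix.cons_val_one, Matrix.cons_val,
        h2, h3, h4, hgx, hggx]
      have hs2 : f x ^ 2 ≤ M ^ 2 := sq_le_sq' (abs_le.1 (hM x)).1 (abs_le.1 (hM x)).2
      have h5 : 0 ≤ f x ^ 2 * (4 * M ^ 2 - f x ^ 2) * (1 - T (oneL2 m) x) := by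
        refine mul_nonneg (mul_nonneg (sq_nonneg _) ?_) (sub_nonneg.2 h1)
        nlinarith [sq_nonneg M]
      linarith)
  simp only [Fin.sum_univ_six, Fin.sum_univ_four, Matrix.cons_val_zero, Matrix.cons_val_one,
    Matrix.cons_val] at i1 i2
  have s1 : inner ℝ (oneL2 m) (T (toL2 m g)) = inner ℝ (toL2 m g) (T (oneL2 m)) := by
    rw [real_inner_comm, E.inner_resolventL2]
  have s2 : inner ℝ (oneL2 m) (T (toL2 m (g * g))) = inner ℝ (toL2 m (g * g)) (T (oneL2 m)) := by
    rw [real_inner_comm, E.inner_resolventL2]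
  have hn : (0 : ℝ) ≤ n + 1 := by positivity
  rw [approxForm, approxForm, inner_sub_left, inner_sub_left, ← hT,
    real_inner_comm (toL2 m g) (T (toL2 m g)), real_inner_comm (toL2 m f) (T (toL2 m f))]
  rw [s1, s2] at i1
  have h9 : inner ℝ (toL2 m g) (toL2 m g) - inner ℝ (toL2 m g) (T (toL2 m g))
      ≤ 4 * M ^ 2 * (inner ℝ (toL2 m f) (toL2 m f) - inner ℝ (toL2 m f) (T (toL2 m f))) := by
    linarith
  calc _ ≤ ((n : ℝ) + 1) * (4 * M ^ 2
        * (inner ℝ (toL2 m f) (toL2 m f) - inner ℝ (toL2 m f) (T (toL2 m f)))) :=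
        mul_le_mul_of_nonneg_left h9 hn
    _ = _ := by ring

theorem InDom.mul_self {E : DirichletForm m} {f : C_c(X, ℝ)} (hf : E.InDom f) :
    E.InDom (f * f) := by
  obtain ⟨M, hM⟩ := exists_abs_le f
  let u : E.FormDomain := ⟨toL2 m f, hf⟩
  obtain ⟨v, hv, -⟩ := E.exists_incl_eq_of_approxForm_le (w := toL2 m (f * f))
    (C := 4 * |M| ^ 2 * E.energy u u) fun n =>
      (E.approxForm_mul_self_le n f (abs_nonneg M) fun x => (hM x).trans (le_abs_self M)).trans
        (mul_le_mul_of_nonneg_left (E.approxForm_incl_le n u) (by positivity))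
  rw [InDom, ← hv]
  exact v.2

theorem InDom.add {E : DirichletForm m} {f g : C_c(X, ℝ)} (hf : E.InDom f) (hg : E.InDom g) :
    E.InDom (f + g) := E.dom.add_mem hf hg

theorem InDom.sub {E : DirichletForm m} {f g : C_c(X, ℝ)} (hf : E.InDom f) (hg : E.InDom g) :
    E.InDom (f - g) := E.dom.sub_mem hf hg

theorem InDom.smul {E : DirichletForm m} {f : C_c(X, ℝ)} (c : ℝ) (hf : E.InDom f) :
    E.InDom (c • f) := E.dom.smul_mem c hf

/-- `C_c(X) ∩ 𝒟(ℰ)` is an algebra. -/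
theorem InDom.mul {E : DirichletForm m} {f g : C_c(X, ℝ)} (hf : E.InDom f) (hg : E.InDom g) :
    E.InDom (f * g) := by
  have h : f * g = (1 / 4 : ℝ) • ((f + g) * (f + g) - (f - g) * (f - g)) := by
    ext x
    simp only [CompactlySupportedContinuousMap.coe_mul, CompactlySupportedContinuousMap.coe_smul,
      CompactlySupportedContinuousMap.coe_add, CompactlySupportedContinuousMap.coe_sub,
      Pi.mul_apply, Pi.add_apply, Pi.sub_apply, Pi.smul_apply, smul_eq_mul]
    ring
  rw [h]
  exact (((hf.add hg).mul_self).sub ((hf.sub hg).mul_self)).smul _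

end ContinuousFunctions

end DirichletForm

/-! ### Testing integrable functions against a core -/

section Testing

variable {X : Type*} [MetricSpace X] [LocallyCompactSpace X] [SecondCountableTopology X]
  [MeasurableSpace X] [BorelSpace X] {m : Measure X} [IsFiniteMeasure m]

theorem ae_nonneg_of_forall_integral_compactlySupported_mul_nonneg {γ : X → ℝ}
    (hγ : Integrable γ m) (h : ∀ φ : C_c(X, ℝ), (∀ x, 0 ≤ φ x) → 0 ≤ ∫ x, φ x * γ x ∂m) :
    0 ≤ᵐ[m] γ := by
  refine ae_nonneg_of_forall_setIntegral_nonneg hγ fun s hs _ => ?_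
  have hf : MemLp (s.indicator fun _ => (1 : ℝ)) 1 m :=
    memLp_indicator_const 1 hs 1 (Or.inr (measure_ne_top _ _))
  have hex : ∀ n : ℕ, ∃ g : X → ℝ, HasCompactSupport g ∧
      eLpNorm ((s.indicator fun _ => (1 : ℝ)) - g) 1 m ≤ ((n : ℝ≥0∞) + 1)⁻¹ ∧ Continuous g ∧
      MemLp g 1 m := fun n =>
    hf.exists_hasCompactSupport_eLpNorm_sub_le ENNReal.one_ne_top (by simp)
  choose g hgs hgn hgc hgm using hex
  have hlim : Tendsto (fun n => eLpNorm (g n - s.indicator fun _ => (1 : ℝ)) 1 m) atTop (𝓝 0) := by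
    have h0 : Tendsto (fun n : ℕ => ((n : ℝ≥0∞) + 1)⁻¹) atTop (𝓝 0) := by
      have := ENNReal.tendsto_inv_nat_nhds_zero.comp (tendsto_add_atTop_nat 1)
      refine this.congr fun n => ?_
      simp
    refine tendsto_of_tendsto_of_tendsto_of_le_of_le tendsto_const_nhds h0 (fun _ => bot_le)
      fun n => ?_
    rw [eLpNorm_sub_comm]
    exact hgn n
  obtain ⟨ns, -, hns⟩ := (tendstoInMeasure_of_tendsto_eLpNorm one_ne_zero
    (fun n => (hgm n).1) hf.1 hlim).exists_seq_tendsto_ae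
  let cut : C(ℝ, ℝ) := ⟨fun t => min (max 0 t) 1, lipschitzWith_unitCut.continuous⟩
  have hcut0 : cut 0 = 0 := by simp [cut]
  let φ : ℕ → C_c(X, ℝ) := fun n =>
    CompactlySupportedContinuousMap.compLeft cut ⟨⟨g (ns n), hgc _⟩, hgs _⟩
  have hφ : ∀ n x, φ n x = min (max 0 (g (ns n) x)) 1 := fun n x => by
    simp only [φ, CompactlySupportedContinuousMap.compLeft_apply hcut0]
    rfl
  have hφ0 : ∀ n x, 0 ≤ φ n x := fun n x => by
    rw [hφ]
    exact le_min (le_max_left _ _) zero_le_one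
  have hφ1 : ∀ n x, φ n x ≤ 1 := fun n x => by
    rw [hφ]
    exact min_le_right _ _
  rw [← integral_indicator hs]
  refine ge_of_tendsto' (f := fun n => ∫ x, φ n x * γ x ∂m) (x := atTop) ?_ fun n => h _ (hφ0 n)
  refine tendsto_integral_of_dominated_convergence (fun x => ‖γ x‖)
    (fun n => ((φ n).continuous.aestronglyMeasurable).mul hγ.1) hγ.norm ?_ ?_
  · intro n
    refine Eventually.of_forall fun x => ?_
    rw [norm_mul, Real.norm_eq_abs, abs_of_nonneg (hφ0 n x)]
    exact mul_le_of_le_one_left (norm_nonneg _) (hφ1 n x)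
  · filter_upwards [hns] with x hx
    have h1 : Tendsto (fun n => φ n x) atTop
        (𝓝 (min (max 0 (s.indicator (fun _ => (1 : ℝ)) x)) 1)) := by
      simp only [hφ]
      exact (lipschitzWith_unitCut.continuous.tendsto _).comp hx
    have h2 := h1.mul_const (γ x)
    convert h2 using 2
    by_cases hxs : x ∈ s <;> simp [hxs]

/-- It suffices to test the sign of an integrable function against the squares of functions from a
uniformly dense subset of `C_c(X)`. -/
theorem ae_nonneg_of_forall_integral_sq_mul_nonneg {A : Set C_c(X, ℝ)}
    (hA : ∀ φ : C_c(X, ℝ), ∀ ε : ℝ, 0 < ε → ∃ f ∈ A, ∀ x, |f x - φ x| < ε) {γ : X → ℝ}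
    (hγ : Integrable γ m) (h : ∀ f ∈ A, 0 ≤ ∫ x, (f * f) x * γ x ∂m) :
    0 ≤ᵐ[m] γ := by
  refine ae_nonneg_of_forall_integral_compactlySupported_mul_nonneg hγ fun φ hφ => ?_
  let rt : C(ℝ, ℝ) := ⟨Real.sqrt, Real.continuous_sqrt⟩
  let ψ : C_c(X, ℝ) := φ.compLeft rt
  have hψ : ∀ x, ψ x * ψ x = φ x := fun x => by
    simp only [ψ, CompactlySupportedContinuousMap.compLeft_apply (g := rt) Real.sqrt_zero]
    exact Real.mul_self_sqrt (hφ x)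
  obtain ⟨M, hM⟩ := DirichletForm.exists_abs_le ψ
  choose f hfA hf using fun n : ℕ => hA ψ (1 / ((n : ℝ) + 1)) (by positivity)
  refine ge_of_tendsto' (f := fun n => ∫ x, (f n * f n) x * γ x ∂m) (x := atTop) ?_
    fun n => h _ (hfA n)
  have hbd : ∀ n x, |f n x| ≤ M + 1 := fun n x => by
    have h1 := (hf n x).le
    have h2 : 1 / ((n : ℝ) + 1) ≤ 1 := by
      rw [div_le_one (by positivity)]
      linarith [(Nat.cast_nonneg n : (0 : ℝ) ≤ n)]
    have h3 := abs_sub_abs_le_abs_sub (f n x) (ψ x)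
    linarith [hM x]
  refine tendsto_integral_of_dominated_convergence (fun x => (M + 1) ^ 2 * ‖γ x‖)
    (fun n => ((f n * f n).continuous.aestronglyMeasurable).mul hγ.1) (hγ.norm.const_mul _) ?_ ?_
  · intro n
    refine Eventually.of_forall fun x => ?_
    rw [norm_mul, CompactlySupportedContinuousMap.coe_mul, Pi.mul_apply, norm_mul, ← sq,
      Real.norm_eq_abs]
    gcongr
    exact hbd n x
  · refine Eventually.of_forall fun x => ?_
    have h1 : Tendsto (fun n => f n x) atTop (𝓝 (ψ x)) := by
      rw [tendsto_iff_dist_tendsto_zero]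
      refine squeeze_zero (fun _ => dist_nonneg) (fun n => ?_)
        (tendsto_one_div_add_atTop_nhds_zero_nat (𝕜 := ℝ))
      rw [Real.dist_eq]
      exact (hf n x).le
    rw [← hψ x]
    exact (h1.mul h1).mul_const _

theorem ae_eq_zero_of_forall_integral_sq_mul_eq_zero {A : Set C_c(X, ℝ)}
    (hA : ∀ φ : C_c(X, ℝ), ∀ ε : ℝ, 0 < ε → ∃ f ∈ A, ∀ x, |f x - φ x| < ε) {γ : X → ℝ}
    (hγ : Integrable γ m) (h : ∀ f ∈ A, ∫ x, (f * f) x * γ x ∂m = 0) :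
    γ =ᵐ[m] 0 := by
  have h1 := ae_nonneg_of_forall_integral_sq_mul_nonneg hA hγ fun f hf => (h f hf).ge
  have h2 := ae_nonneg_of_forall_integral_sq_mul_nonneg hA hγ.neg fun f hf => by
    simp only [Pi.neg_apply, mul_neg, integral_neg, h f hf, neg_zero, le_refl]
  filter_upwards [h1, h2] with x hx1 hx2
  simp only [Pi.zero_apply, Pi.neg_apply] at *
  linarith

end Testing

/-! ### The carré du champ on continuous functions -/

namespace DirichletForm

section Algebra

variable {X : Type*} [TopologicalSpace X] [MeasurableSpace X] [BorelSpace X] {m : Measure X}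
  [IsFiniteMeasure m]

/-- The space `C_c(X) ∩ 𝒟(ℰ)`, as a subspace of `C_c(X)`. -/
def contSubmodule (E : DirichletForm m) : Submodule ℝ C_c(X, ℝ) where
  carrier := {f | E.InDom f}
  add_mem' := InDom.add
  zero_mem' := E.dom.zero_mem
  smul_mem' := fun c _ hf => InDom.smul c hf

/-- The space `C_c(X) ∩ 𝒟(ℰ)`, as a type. -/
def ContDomain (E : DirichletForm m) : Type _ := E.contSubmodule

noncomputable instance (E : DirichletForm m) : AddCommGroup E.ContDomain :=
  inferInstanceAs (AddCommGroup E.contSubmodule)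

noncomputable instance (E : DirichletForm m) : Module ℝ E.ContDomain :=
  inferInstanceAs (Module ℝ E.contSubmodule)

/-- A continuous function of the form domain as an element of `C_c(X) ∩ 𝒟(ℰ)`. -/
def ContDomain.mk {E : DirichletForm m} (f : C_c(X, ℝ)) (hf : E.InDom f) : E.ContDomain := ⟨f, hf⟩

/-- The pointwise product of functions of `C_c(X) ∩ 𝒟(ℰ)`. -/
noncomputable instance (E : DirichletForm m) : Mul E.ContDomain where
  mul f g := ⟨f.1 * g.1, InDom.mul f.2 g.2⟩

theorem contDomain_mul_comm {E : DirichletForm m} (f g : E.ContDomain) : f * g = g * f :=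
  Subtype.ext (mul_comm f.1 g.1)

theorem contDomain_add_mul {E : DirichletForm m} (f g h : E.ContDomain) :
    (f + g) * h = f * h + g * h :=
  Subtype.ext (add_mul f.1 g.1 h.1)

theorem contDomain_smul_mul {E : DirichletForm m} (c : ℝ) (f g : E.ContDomain) :
    (c • f) * g = c • (f * g) :=
  Subtype.ext (smul_mul_assoc c f.1 g.1)

/-- The map sending a function of `C_c(X) ∩ 𝒟(ℰ)` to its class in the form domain. -/
noncomputable def ofCont (E : DirichletForm m) : E.ContDomain →ₗ[ℝ] E.FormDomain where
  toFun f := ⟨toL2 m f.1, f.2⟩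
  map_add' _ _ := rfl
  map_smul' _ _ := rfl

theorem incl_ofCont (E : DirichletForm m) (f : E.ContDomain) :
    E.incl (E.ofCont f) = toL2 m f.1 := rfl

theorem val_toL2 (E : DirichletForm m) (f g : E.ContDomain) :
    E.val (toL2 m f.1) (toL2 m g.1) = E.energy (E.ofCont f) (E.ofCont g) := by
  have h : toL2 m f.1 ∈ E.dom ∧ toL2 m g.1 ∈ E.dom := ⟨f.2, g.2⟩
  rw [val, dif_pos h]
  rfl

theorem isMutualDensity_iff (E : DirichletForm m) (f g : E.ContDomain) (γ : Lp ℝ 1 m) :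
    E.IsMutualDensity f.1 g.1 γ ↔ ∀ h : E.ContDomain,
      (1 / 2 : ℝ) * (E.energy (E.ofCont (f * h)) (E.ofCont g)
        + E.energy (E.ofCont (g * h)) (E.ofCont f)
        - E.energy (E.ofCont (f * g)) (E.ofCont h)) = ∫ x, h.1 x * γ x ∂m := by
  constructor
  · intro H h
    rw [← H h.1 h.2, ← val_toL2, ← val_toL2, ← val_toL2]
    rfl
  · intro H h hh
    have := H (.mk h hh)
    rw [← val_toL2, ← val_toL2, ← val_toL2] at this
    exact this

theorem StandingAssumption.isMutualDensity {E : DirichletForm m}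
    {A : NonUnitalSubalgebra ℝ C_c(X, ℝ)} (hE : E.StandingAssumption A) (f g : E.ContDomain) :
    E.IsMutualDensity f.1 g.1 (E.carreDuChamp f.1 g.1) := by
  have h := hE.admitsCarreDuChamp f.1 g.1 f.2 g.2
  rw [carreDuChamp, dif_pos h]
  exact h.choose_spec

theorem integrable_compactlySupported_mul {X : Type*} [TopologicalSpace X] [MeasurableSpace X]
    [BorelSpace X] {m : Measure X} (h : C_c(X, ℝ)) {γ : X → ℝ} (hγ : Integrable γ m) :
    Integrable (fun x => h x * γ x) m := by
  obtain ⟨M, hM⟩ := exists_abs_le h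
  exact hγ.bdd_mul h.continuous.aestronglyMeasurable (Eventually.of_forall hM)

end Algebra

section CarreDuChamp

variable {X : Type*} [MetricSpace X] [LocallyCompactSpace X] [SecondCountableTopology X]
  [MeasurableSpace X] [BorelSpace X] {m : Measure X} [IsFiniteMeasure m] {E : DirichletForm m}
  {A : NonUnitalSubalgebra ℝ C_c(X, ℝ)}

theorem StandingAssumption.carreDuChamp_eq (hE : E.StandingAssumption A) (f g : E.ContDomain)
    {γ : Lp ℝ 1 m} (hγ : E.IsMutualDensity f.1 g.1 γ) : E.carreDuChamp f.1 g.1 = γ := by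
  have h1 := hE.isMutualDensity f g
  have hi1 := L1.integrable_coeFn (E.carreDuChamp f.1 g.1)
  have hi2 := L1.integrable_coeFn γ
  have h3 := ae_eq_zero_of_forall_integral_sq_mul_eq_zero hE.core.uniformly_dense
    (hi1.sub hi2) fun h hh => by
      have hd : E.InDom (h * h) := (hE.core.inDom h hh).mul_self
      have h4 := (h1 (h * h) hd).symm.trans (hγ (h * h) hd)
      simp only [Pi.sub_apply, mul_sub]
      rw [integral_sub (integrable_compactlySupported_mul _ hi1)
        (integrable_compactlySupported_mul _ hi2), h4, sub_self]
  refine Lp.ext ?_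
  filter_upwards [h3] with x hx
  simpa [sub_eq_zero] using hx

theorem StandingAssumption.carreDuChamp_symm (hE : E.StandingAssumption A) (f g : E.ContDomain) :
    E.carreDuChamp f.1 g.1 = E.carreDuChamp g.1 f.1 := by
  refine hE.carreDuChamp_eq f g ?_
  have h := hE.isMutualDensity g f
  rw [isMutualDensity_iff] at h ⊢
  intro k
  rw [← h k, contDomain_mul_comm g f]
  ring

/-- The carré du champ as a bilinear map on `C_c(X) ∩ 𝒟(ℰ)` with values in `L¹(X, m)`. -/
noncomputable def StandingAssumption.contGamma (hE : E.StandingAssumption A) :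
    E.ContDomain →ₗ[ℝ] E.ContDomain →ₗ[ℝ] Lp ℝ 1 m :=
  have add_left : ∀ f f' g : E.ContDomain, E.carreDuChamp (f + f').1 g.1
      = E.carreDuChamp f.1 g.1 + E.carreDuChamp f'.1 g.1 := fun f f' g => by
    refine hE.carreDuChamp_eq (f + f') g ?_
    have h := hE.isMutualDensity f g
    have h' := hE.isMutualDensity f' g
    rw [isMutualDensity_iff] at h h' ⊢
    intro k
    have e : ∫ x, k.1 x * (E.carreDuChamp f.1 g.1 + E.carreDuChamp f'.1 g.1 : Lp ℝ 1 m) x ∂m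
        = (∫ x, k.1 x * E.carreDuChamp f.1 g.1 x ∂m)
          + ∫ x, k.1 x * E.carreDuChamp f'.1 g.1 x ∂m := by
      rw [← integral_add (integrable_compactlySupported_mul _ (L1.integrable_coeFn _))
        (integrable_compactlySupported_mul _ (L1.integrable_coeFn _))]
      refine integral_congr_ae ?_
      filter_upwards [Lp.coeFn_add (E.carreDuChamp f.1 g.1) (E.carreDuChamp f'.1 g.1)] with x hx
      rw [hx, Pi.add_apply, mul_add]
    rw [e, ← h k, ← h' k]
    simp only [contDomain_add_mul, map_add, LinearMap.add_apply]
    ring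
  have smul_left : ∀ (c : ℝ) (f g : E.ContDomain), E.carreDuChamp (c • f).1 g.1
      = c • E.carreDuChamp f.1 g.1 := fun c f g => by
    refine hE.carreDuChamp_eq (c • f) g ?_
    have h := hE.isMutualDensity f g
    rw [isMutualDensity_iff] at h ⊢
    intro k
    have e : ∫ x, k.1 x * (c • E.carreDuChamp f.1 g.1 : Lp ℝ 1 m) x ∂m
        = c * ∫ x, k.1 x * E.carreDuChamp f.1 g.1 x ∂m := by
      rw [← integral_const_mul]
      refine integral_congr_ae ?_
      filter_upwards [Lp.coeFn_smul c (E.carreDuChamp f.1 g.1)] with x hx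
      rw [hx, Pi.smul_apply, smul_eq_mul]
      ring
    rw [e, ← h k]
    simp only [contDomain_smul_mul, map_smul, LinearMap.smul_apply, smul_eq_mul]
    ring
  LinearMap.mk₂ ℝ (fun f g => E.carreDuChamp f.1 g.1) add_left smul_left
    (fun f g g' => by
      rw [hE.carreDuChamp_symm f, add_left, hE.carreDuChamp_symm f, hE.carreDuChamp_symm f])
    (fun c f g => by
      rw [hE.carreDuChamp_symm f, smul_left, hE.carreDuChamp_symm f])

theorem StandingAssumption.integral_mul_contGamma (hE : E.StandingAssumption A)
    (f g h : E.ContDomain) :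
    ∫ x, h.1 x * hE.contGamma f g x ∂m = (1 / 2 : ℝ) * (E.energy (E.ofCont (f * h)) (E.ofCont g)
        + E.energy (E.ofCont (g * h)) (E.ofCont f)
        - E.energy (E.ofCont (f * g)) (E.ofCont h)) :=
  ((E.isMutualDensity_iff f g _).1 (hE.isMutualDensity f g) h).symm

theorem StandingAssumption.contGamma_self_nonneg (hE : E.StandingAssumption A)
    (f : E.ContDomain) : 0 ≤ᵐ[m] hE.contGamma f f := by
  refine ae_nonneg_of_forall_integral_sq_mul_nonneg hE.core.uniformly_dense
    (L1.integrable_coeFn _) fun h hh => ?_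
  let k : E.ContDomain := .mk h (hE.core.inDom h hh)
  have h1 := hE.integral_mul_contGamma f f (k * k)
  change 0 ≤ ∫ x, (k * k).1 x * hE.contGamma f f x ∂m
  have h2 := (E.tendsto_approxForm (E.ofCont (f * (k * k))) (E.ofCont f)).sub
    ((E.tendsto_approxForm (E.ofCont (f * f)) (E.ofCont (k * k))).const_mul (1 / 2))
  have h3 := ge_of_tendsto' h2 fun n =>
    E.approxForm_density_nonneg n f.1 (k * k).1 fun x => mul_self_nonneg (h x)
  rw [h1]
  linarith

/-- Cut-off functions in `C_c(X) ∩ 𝒟(ℰ)`. -/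
theorem StandingAssumption.exists_cutoff (hE : E.StandingAssumption A) {K : Set X}
    (hK : IsCompact K) : ∃ h : E.ContDomain, (∀ x, 0 ≤ h.1 x) ∧ (∀ x, h.1 x ≤ 1) ∧
      ∃ U : Set X, IsOpen U ∧ K ⊆ U ∧ ∀ x ∈ U, h.1 x = 1 := by
  obtain ⟨K', hK', hKK'⟩ := exists_compact_superset hK
  obtain ⟨ψ, hψ1, -, hψc, -⟩ := exists_continuous_one_zero_of_isCompact hK' isClosed_empty
    (Set.disjoint_empty K')
  let Ψ : C_c(X, ℝ) := (3 : ℝ) • ⟨ψ, hψc⟩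
  obtain ⟨φ, hφA, hφ⟩ := hE.core.uniformly_dense Ψ 1 one_pos
  let cut : C(ℝ, ℝ) := ⟨fun t => min (max 0 t) 1, lipschitzWith_unitCut.continuous⟩
  have hcut0 : cut 0 = 0 := by simp [cut]
  have hh : ∀ x, φ.compLeft cut x = min (max 0 (φ x)) 1 := fun x => by
    rw [CompactlySupportedContinuousMap.compLeft_apply hcut0]
    rfl
  refine ⟨.mk (φ.compLeft cut) ?_, fun x => ?_, fun x => ?_, interior K', isOpen_interior, hKK',
    fun x hx => ?_⟩
  · obtain ⟨h1, -⟩ := E.markov ⟨toL2 m φ, hE.core.inDom φ hφA⟩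
    have h2 : toL2 m (φ.compLeft cut) = unitContraction (toL2 m φ) := by
      refine Lp.ext ?_
      filter_upwards [coeFn_toL2 (m := m) (φ.compLeft cut), coeFn_unitContraction (toL2 m φ),
        coeFn_toL2 (m := m) φ] with x hx1 hx2 hx3
      rw [hx1, hx2, hx3, hh]
    change toL2 m (φ.compLeft cut) ∈ E.dom
    rw [h2]
    exact h1
  · change 0 ≤ φ.compLeft cut x
    rw [hh]
    exact le_min (le_max_left _ _) zero_le_one
  · change φ.compLeft cut x ≤ 1
    rw [hh]
    exact min_le_right _ _
  · change φ.compLeft cut x = 1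
    have h1 : Ψ x = 3 := by
      have h2 : ψ x = 1 := hψ1 (interior_subset hx)
      have h3 : Ψ x = 3 * ψ x := rfl
      rw [h3, h2, mul_one]
    have h4 := hφ x
    rw [h1, abs_lt] at h4
    rw [hh, max_eq_right (by linarith), min_eq_right (by linarith)]

/-- Strong locality excludes killing: the total mass of `Γ(f, f)` is `ℰ(f, f)`. -/
theorem StandingAssumption.integral_contGamma_self (hE : E.StandingAssumption A)
    (f : E.ContDomain) :
    ∫ x, hE.contGamma f f x ∂m = E.energy (E.ofCont f) (E.ofCont f) := by
  have hex := fun n : ℕ => hE.exists_cutoff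
    ((isCompact_compactCovering X n).union f.1.hasCompactSupport)
  choose h h0 h1 U hU hKU hU1 using hex
  have hint : ∀ n, ∫ x, (h n).1 x * hE.contGamma f f x ∂m
      = E.energy (E.ofCont f) (E.ofCont f) := by
    intro n
    have e1 : f * h n = f := by
      refine Subtype.ext (CompactlySupportedContinuousMap.ext fun x => ?_)
      change f.1 x * (h n).1 x = f.1 x
      by_cases hx : x ∈ tsupport f.1
      · rw [hU1 n x (hKU n (Or.inr hx)), mul_one]
      · rw [image_eq_zero_of_notMem_tsupport hx, zero_mul]
    have e2 : E.energy (E.ofCont (f * f)) (E.ofCont (h n)) = 0 := by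
      refine hE.stronglyLocal (f * f).1 (h n).1 (f * f).2 (h n).2 ⟨U n, hU n, ?_, 1, hU1 n⟩
      exact (tsupport_mul_subset_left (f := f.1) (g := f.1)).trans
        (Set.subset_union_right.trans (hKU n))
    rw [integral_mul_contGamma, e1, e2]
    ring
  have hlim : Tendsto (fun n => ∫ x, (h n).1 x * hE.contGamma f f x ∂m) atTop
      (𝓝 (∫ x, hE.contGamma f f x ∂m)) := by
    have hγ := L1.integrable_coeFn (hE.contGamma f f)
    refine tendsto_integral_of_dominated_convergence (fun x => ‖hE.contGamma f f x‖)
      (fun n => ((h n).1.continuous.aestronglyMeasurable).mul hγ.1) hγ.norm ?_ ?_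
    · intro n
      refine Eventually.of_forall fun x => ?_
      rw [norm_mul, Real.norm_eq_abs, abs_of_nonneg (h0 n x)]
      exact mul_le_of_le_one_left (norm_nonneg _) (h1 n x)
    · refine Eventually.of_forall fun x => ?_
      obtain ⟨N, hN⟩ := exists_mem_compactCovering x
      refine tendsto_const_nhds.congr' ?_
      filter_upwards [eventually_ge_atTop N] with n hn
      rw [hU1 n x (hKU n (Or.inl (compactCovering_subset X hn hN))), one_mul]
  simp only [hint] at hlim
  exact tendsto_nhds_unique hlim tendsto_const_nhds

theorem StandingAssumption.denseRange_ofCont (hE : E.StandingAssumption A) :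
    DenseRange E.ofCont := by
  intro u
  rw [Metric.mem_closure_iff]
  intro ε hε
  obtain ⟨f, -, hf, h⟩ := hE.core.dense u (ε ^ 2) (by positivity)
  refine ⟨E.ofCont (.mk f hf), ⟨_, rfl⟩, ?_⟩
  rw [normSq_eq_formDomain_norm_sq] at h
  rw [dist_comm, dist_eq_norm]
  exact lt_of_pow_lt_pow_left₀ 2 hε.le h

end CarreDuChamp

end DirichletForm

/-! ### Cauchy–Schwarz inequalities for `L¹`-valued bilinear maps -/

section L1Valued

variable {X : Type*} [MeasurableSpace X] {m : Measure X} {V : Type*} [AddCommGroup V] [Module ℝ V]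
  (B : V →ₗ[ℝ] V →ₗ[ℝ] Lp ℝ 1 m)

theorem ae_bilin_sub (u u' v : V) : B (u - u') v =ᵐ[m] fun x => B u v x - B u' v x := by
  rw [map_sub, LinearMap.sub_apply]
  exact Lp.coeFn_sub _ _

variable {B} (hs : ∀ u v, B u v = B v u) (hn : ∀ u, 0 ≤ᵐ[m] B u u)

include hs hn

/-- The pointwise Cauchy–Schwarz inequality. -/
theorem ae_abs_bilin_le (u v : V) :
    ∀ᵐ x ∂m, |B u v x| ≤ √(B u u x) * √(B v v x) := by
  have h1 : ∀ᵐ x ∂m, ∀ q : ℚ, 0 ≤ B v v x * (q * q) + 2 * B u v x * q + B u u x := by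
    rw [ae_all_iff]
    intro q
    have e : B (u + (q : ℝ) • v) (u + (q : ℝ) • v)
        = B u u + ((2 * q : ℝ) • B u v + (q * q : ℝ) • B v v) := by
      simp only [map_add, map_smul, LinearMap.add_apply, LinearMap.smul_apply, smul_add]
      rw [hs v u, mul_smul, mul_smul, two_smul]
      abel
    filter_upwards [hn (u + (q : ℝ) • v), Lp.coeFn_add (B u u)
      ((2 * q : ℝ) • B u v + (q * q : ℝ) • B v v), Lp.coeFn_add ((2 * q : ℝ) • B u v)
      ((q * q : ℝ) • B v v), Lp.coeFn_smul (2 * q : ℝ) (B u v), Lp.coeFn_smul (q * q : ℝ) (B v v)]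
      with x hx0 hx1 hx2 hx3 hx4
    rw [e, hx1, Pi.add_apply, hx2, Pi.add_apply, hx3, hx4] at hx0
    simp only [Pi.zero_apply, Pi.smul_apply, smul_eq_mul] at hx0
    linarith
  filter_upwards [h1, hn u] with x hx hu
  have hcont : Continuous fun t : ℝ => B v v x * (t * t) + 2 * B u v x * t + B u u x := by
    fun_prop
  have h2 : ∀ t : ℝ, 0 ≤ B v v x * (t * t) + 2 * B u v x * t + B u u x := fun t =>
    Rat.isDenseEmbedding_coe_real.dense.induction
      (P := fun t : ℝ => 0 ≤ B v v x * (t * t) + 2 * B u v x * t + B u u x)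
      (by rintro _ ⟨q, rfl⟩; exact hx q) (isClosed_le continuous_const hcont) t
  have h3 := discrim_le_zero h2
  rw [discrim] at h3
  rw [← Real.sqrt_mul hu]
  refine Real.abs_le_sqrt ?_
  linarith

/-- The pointwise triangle inequality for `√B(u, u)`. -/
theorem ae_sqrt_bilin_add_le (u v : V) :
    ∀ᵐ x ∂m, √(B (u + v) (u + v) x) ≤ √(B u u x) + √(B v v x) := by
  have e : B (u + v) (u + v) = B u u + ((2 : ℝ) • B u v + B v v) := by
    simp only [map_add, LinearMap.add_apply]
    rw [hs v u, two_smul]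
    abel
  filter_upwards [ae_abs_bilin_le hs hn u v, hn u, hn v, Lp.coeFn_add (B u u)
    ((2 : ℝ) • B u v + B v v), Lp.coeFn_add ((2 : ℝ) • B u v) (B v v),
    Lp.coeFn_smul (2 : ℝ) (B u v)] with x h1 h2 h3 h4 h5 h6
  rw [e, h4, Pi.add_apply, h5, Pi.add_apply, h6, Pi.smul_apply, smul_eq_mul]
  refine Real.sqrt_le_iff.2 ⟨by positivity, ?_⟩
  nlinarith [Real.sq_sqrt h2, Real.sq_sqrt h3, le_abs_self (B u v x)]

omit hs hn in
theorem bilin_neg_neg (u : V) : B (-u) (-u) = B u u := by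
  simp

theorem ae_abs_sqrt_bilin_sub_le (u v : V) :
    ∀ᵐ x ∂m, |√(B u u x) - √(B v v x)| ≤ √(B (u - v) (u - v) x) := by
  have h1 := ae_sqrt_bilin_add_le hs hn (u - v) v
  have h2 := ae_sqrt_bilin_add_le hs hn (v - u) u
  rw [sub_add_cancel] at h1 h2
  have h3 : B (v - u) (v - u) = B (u - v) (u - v) := by rw [← neg_sub u v, bilin_neg_neg]
  rw [h3] at h2
  filter_upwards [h1, h2] with x hx1 hx2
  rw [abs_le]
  constructor <;> linarith

omit hs in
theorem norm_bilin_self (u : V) : ‖B u u‖ = ∫ x, B u u x ∂m := by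
  rw [L1.norm_eq_integral_norm]
  refine integral_congr_ae ?_
  filter_upwards [hn u] with x hx
  exact Real.norm_of_nonneg hx

theorem norm_bilin_le (u v : V) : ‖B u v‖ ≤ √‖B u u‖ * √‖B v v‖ := by
  have hm : ∀ w, MemLp (fun x => √(B w w x)) 2 m := fun w => by
    have hmeas : AEStronglyMeasurable (fun x => √(B w w x)) m :=
      Real.continuous_sqrt.comp_aestronglyMeasurable (Lp.aestronglyMeasurable _)
    rw [memLp_two_iff_integrable_sq hmeas]
    refine (L1.integrable_coeFn (B w w)).congr ?_
    filter_upwards [hn w] with x hx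
    exact (Real.sq_sqrt hx).symm
  have hsq : ∀ w, ∫ x, √(B w w x) ^ (2 : ℝ) ∂m = ‖B w w‖ := fun w => by
    rw [norm_bilin_self hn]
    refine integral_congr_ae ?_
    filter_upwards [hn w] with x hx
    rw [Real.rpow_two]
    exact Real.sq_sqrt hx
  have h := integral_mul_le_Lp_mul_Lq_of_nonneg (μ := m) Real.HolderConjugate.two_two
    (f := fun x => √(B u u x)) (g := fun x => √(B v v x))
    (Eventually.of_forall fun x => Real.sqrt_nonneg _)
    (Eventually.of_forall fun x => Real.sqrt_nonneg _)
    (by simpa using hm u) (by simpa using hm v)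
  rw [hsq, hsq, ← Real.sqrt_eq_rpow, ← Real.sqrt_eq_rpow] at h
  refine le_trans ?_ h
  rw [L1.norm_eq_integral_norm]
  refine integral_mono_ae (L1.integrable_coeFn _).norm ((hm u).integrable_mul (hm v)) ?_
  filter_upwards [ae_abs_bilin_le hs hn u v] with x hx
  exact hx

end L1Valued

/-! ### Extension of the carré du champ to the form domain -/

/-- A bilinear map that is bounded with respect to a linear map `ι` with dense range extends along
`ι`. -/
theorem exists_bilin_extension {V H F : Type*} [AddCommGroup V] [Module ℝ V]
    [NormedAddCommGroup H] [NormedSpace ℝ H] [NormedAddCommGroup F] [NormedSpace ℝ F]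
    [CompleteSpace F] (B : V →ₗ[ℝ] V →ₗ[ℝ] F) (ι : V →ₗ[ℝ] H) (hι : DenseRange ι)
    (hB : ∀ u v, ‖B u v‖ ≤ ‖ι u‖ * ‖ι v‖) :
    ∃ G : H →L[ℝ] H →L[ℝ] F, ∀ u v, G (ι u) (ι v) = B u v := by
  have h1 : ∀ u v, (B u).extendOfNorm ι (ι v) = B u v := fun u v =>
    LinearMap.extendOfNorm_eq hι ⟨‖ι u‖, hB u⟩ v
  let L : V →ₗ[ℝ] H →L[ℝ] F :=
    { toFun := fun u => (B u).extendOfNorm ι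
      map_add' := fun u u' => by
        refine DFunLike.coe_injective (hι.equalizer (by fun_prop) (by fun_prop) ?_)
        funext v
        exact (h1 _ v).trans (by simp [h1])
      map_smul' := fun c u => by
        refine DFunLike.coe_injective (hι.equalizer (by fun_prop) (by fun_prop) ?_)
        funext v
        exact (h1 _ v).trans (by simp [h1]) }
  have hL : ∀ u, ‖L u‖ ≤ 1 * ‖ι u‖ := fun u => by
    rw [one_mul]
    exact LinearMap.opNorm_extendOfNorm_le hι (norm_nonneg _) (hB u)
  refine ⟨L.extendOfNorm ι, fun u v => ?_⟩
  rw [LinearMap.extendOfNorm_eq hι ⟨1, hL⟩]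
  exact h1 u v

namespace DirichletForm

section Extension

variable {X : Type*} [MetricSpace X] [LocallyCompactSpace X] [SecondCountableTopology X]
  [MeasurableSpace X] [BorelSpace X] {m : Measure X} [IsFiniteMeasure m] {E : DirichletForm m}
  {A : NonUnitalSubalgebra ℝ C_c(X, ℝ)}

theorem StandingAssumption.norm_contGamma_self (hE : E.StandingAssumption A)
    (f : E.ContDomain) : ‖hE.contGamma f f‖ = E.energy (E.ofCont f) (E.ofCont f) := by
  rw [norm_bilin_self (B := hE.contGamma) hE.contGamma_self_nonneg, hE.integral_contGamma_self]

theorem StandingAssumption.norm_contGamma_le (hE : E.StandingAssumption A)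
    (f g : E.ContDomain) : ‖hE.contGamma f g‖ ≤ ‖E.ofCont f‖ * ‖E.ofCont g‖ := by
  refine (norm_bilin_le (B := hE.contGamma) hE.carreDuChamp_symm
    hE.contGamma_self_nonneg f g).trans ?_
  have h : ∀ k : E.ContDomain, √‖hE.contGamma k k‖ ≤ ‖E.ofCont k‖ := fun k => by
    rw [hE.norm_contGamma_self]
    exact Real.sqrt_le_iff.2 ⟨norm_nonneg _, E.energy_le_norm_sq _⟩
  exact mul_le_mul (h f) (h g) (Real.sqrt_nonneg _) (norm_nonneg _)

/-- The carré du champ on the form domain, as a continuous bilinear map. -/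
noncomputable def StandingAssumption.gammaL (hE : E.StandingAssumption A) :
    E.FormDomain →L[ℝ] E.FormDomain →L[ℝ] Lp ℝ 1 m :=
  (exists_bilin_extension hE.contGamma E.ofCont hE.denseRange_ofCont hE.norm_contGamma_le).choose

/-- The carré du champ on the form domain, as a bilinear map. -/
noncomputable def StandingAssumption.gamma (hE : E.StandingAssumption A) :
    E.FormDomain →ₗ[ℝ] E.FormDomain →ₗ[ℝ] Lp ℝ 1 m :=
  hE.gammaL.toLinearMap₁₂

theorem StandingAssumption.gammaL_eq (hE : E.StandingAssumption A) (u v : E.FormDomain) :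
    hE.gammaL u v = hE.gamma u v := rfl

theorem StandingAssumption.continuous_gamma (hE : E.StandingAssumption A) :
    Continuous fun p : E.FormDomain × E.FormDomain => hE.gamma p.1 p.2 := by
  simp only [← gammaL_eq]
  fun_prop

theorem StandingAssumption.gamma_ofCont (hE : E.StandingAssumption A) (f g : E.ContDomain) :
    hE.gamma (E.ofCont f) (E.ofCont g) = E.carreDuChamp f.1 g.1 :=
  (exists_bilin_extension hE.contGamma E.ofCont hE.denseRange_ofCont
    hE.norm_contGamma_le).choose_spec f g

theorem StandingAssumption.gamma_symm (hE : E.StandingAssumption A) (u v : E.FormDomain) :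
    hE.gamma u v = hE.gamma v u := by
  refine hE.denseRange_ofCont.induction_on₂ (p := fun u v => hE.gamma u v = hE.gamma v u) ?_ ?_ u v
  · exact isClosed_eq hE.continuous_gamma (hE.continuous_gamma.comp continuous_swap)
  · intro f g
    rw [gamma_ofCont, gamma_ofCont, hE.carreDuChamp_symm]

theorem StandingAssumption.gamma_self_nonneg (hE : E.StandingAssumption A) (u : E.FormDomain) :
    0 ≤ᵐ[m] hE.gamma u u := by
  rw [Lp.coeFn_nonneg]
  refine hE.denseRange_ofCont.induction_on (p := fun u => 0 ≤ hE.gamma u u) u ?_ ?_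
  · exact isClosed_le continuous_const
      (hE.continuous_gamma.comp (continuous_id.prodMk continuous_id))
  · intro f
    rw [gamma_ofCont, ← Lp.coeFn_nonneg]
    exact hE.contGamma_self_nonneg f

theorem StandingAssumption.norm_gamma_self (hE : E.StandingAssumption A) (u : E.FormDomain) :
    ‖hE.gamma u u‖ = E.energy u u := by
  refine hE.denseRange_ofCont.induction_on (p := fun u => ‖hE.gamma u u‖ = E.energy u u) u ?_ ?_
  · refine isClosed_eq
      (hE.continuous_gamma.comp (continuous_id.prodMk continuous_id)).norm ?_
    have : (fun u => E.energy u u) = fun u => ‖u‖ ^ 2 - ‖E.incl u‖ ^ 2 := by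
      ext u
      rw [formDomain_norm_sq']
      ring
    rw [this]
    fun_prop
  · intro f
    rw [gamma_ofCont]
    exact hE.norm_contGamma_self f

/-- Any energy density of `u`, in the sense of approximation by continuous functions, is
`Γ(u, u)`. -/
theorem StandingAssumption.eq_gamma_of_isEnergyDensity (hE : E.StandingAssumption A)
    {u : E.dom} {γ : Lp ℝ 1 m} (h : E.IsEnergyDensity u γ) :
    γ = hE.gamma (show E.FormDomain from u) (show E.FormDomain from u) := by
  obtain ⟨f, hf, h1, h2⟩ := h
  let u' : E.FormDomain := u
  let F : ℕ → E.ContDomain := fun n => .mk (f n) (hf n)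
  have h3 : Tendsto (fun n => E.ofCont (F n)) atTop (𝓝 u') := by
    rw [tendsto_iff_norm_sub_tendsto_zero]
    have h4 : Tendsto (fun n => ‖E.ofCont (F n) - u'‖ ^ 2) atTop (𝓝 0) :=
      h1.congr fun n => E.normSq_eq_formDomain_norm_sq _
    simpa [Real.sqrt_sq (norm_nonneg _)] using h4.sqrt
  have h5 := (hE.continuous_gamma.tendsto (u', u')).comp (h3.prodMk_nhds h3)
  refine tendsto_nhds_unique h2 (h5.congr fun n => ?_)
  exact hE.gamma_ofCont (F n) (F n)

theorem continuous_integral_compactlySupported_mul {X : Type*} [TopologicalSpace X]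
    [MeasurableSpace X] [BorelSpace X] {m : Measure X} (f : C_c(X, ℝ)) :
    Continuous fun γ : Lp ℝ 1 m => ∫ x, f x * γ x ∂m := by
  obtain ⟨M, hM⟩ := exists_abs_le f
  have hM' : ∀ x, |f x| ≤ |M| := fun x => (hM x).trans (le_abs_self M)
  refine (LipschitzWith.of_dist_le_mul (K := Real.toNNReal |M|) fun γ γ' => ?_).continuous
  rw [Real.dist_eq, dist_eq_norm, L1.norm_eq_integral_norm, Real.coe_toNNReal _ (abs_nonneg M),
    ← integral_const_mul,
    ← integral_sub (integrable_compactlySupported_mul f (L1.integrable_coeFn γ))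
      (integrable_compactlySupported_mul f (L1.integrable_coeFn γ')), ← Real.norm_eq_abs]
  refine norm_integral_le_of_norm_le ((L1.integrable_coeFn _).norm.const_mul _) ?_
  filter_upwards [Lp.coeFn_sub γ γ'] with x hx
  rw [hx, Pi.sub_apply, ← mul_sub, norm_mul]
  gcongr
  exact hM' x

/-- Integration by parts: `Γ` satisfies the integrated Leibniz rule. -/
theorem StandingAssumption.integral_mul_gamma_add (hE : E.StandingAssumption A)
    (f g : E.ContDomain) (u : E.FormDomain) :
    (∫ x, g.1 x * hE.gamma (E.ofCont f) u x ∂m) + ∫ x, f.1 x * hE.gamma (E.ofCont g) u x ∂m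
      = E.energy (E.ofCont (f * g)) u := by
  refine hE.denseRange_ofCont.induction_on (p := fun u =>
    (∫ x, g.1 x * hE.gamma (E.ofCont f) u x ∂m) + ∫ x, f.1 x * hE.gamma (E.ofCont g) u x ∂m
      = E.energy (E.ofCont (f * g)) u) u ?_ ?_
  · refine isClosed_eq (Continuous.add ?_ ?_) ?_
    · exact (continuous_integral_compactlySupported_mul g.1).comp
        (hE.continuous_gamma.comp (continuous_const.prodMk continuous_id))
    · exact (continuous_integral_compactlySupported_mul f.1).comp
        (hE.continuous_gamma.comp (continuous_const.prodMk continuous_id))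
    · exact (E.continuous_energy_left (E.ofCont (f * g))).congr fun u => E.energy_symm _ _
  · intro k
    have h1 : ∫ x, g.1 x * E.carreDuChamp f.1 k.1 x ∂m = _ := hE.integral_mul_contGamma f k g
    have h2 : ∫ x, f.1 x * E.carreDuChamp g.1 k.1 x ∂m = _ := hE.integral_mul_contGamma g k f
    rw [gamma_ofCont, gamma_ofCont, h1, h2, contDomain_mul_comm g f, contDomain_mul_comm k g,
      contDomain_mul_comm k f]
    ring

end Extension

end DirichletForm

/-! ### Completion with respect to a closable seminorm -/

namespace DirichletForm

section ClosableSeminorm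

variable {V L : Type*} [AddCommGroup V] [Module ℝ V] [NormedAddCommGroup L] [NormedSpace ℝ L]

/-- `F` is a Cauchy sequence for the seminorm `N`. -/
def SeminormCauchy (N : Seminorm ℝ V) (F : ℕ → V) : Prop :=
  ∀ ε : ℝ, 0 < ε → ∃ M : ℕ, ∀ n, M ≤ n → ∀ k, M ≤ k → N (F n - F k) < ε

theorem SeminormCauchy.add {N : Seminorm ℝ V} {F G : ℕ → V} (hF : SeminormCauchy N F)
    (hG : SeminormCauchy N G) : SeminormCauchy N fun n => F n + G n := by
  intro ε hε
  obtain ⟨M1, h1⟩ := hF (ε / 2) (by positivity)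
  obtain ⟨M2, h2⟩ := hG (ε / 2) (by positivity)
  refine ⟨max M1 M2, fun n hn k hk => ?_⟩
  have h3 := h1 n ((le_max_left _ _).trans hn) k ((le_max_left _ _).trans hk)
  have h4 := h2 n ((le_max_right _ _).trans hn) k ((le_max_right _ _).trans hk)
  have h5 := map_add_le_add N (F n - F k) (G n - G k)
  rw [sub_add_sub_comm] at h5
  linarith

theorem SeminormCauchy.smul {N : Seminorm ℝ V} {F : ℕ → V} (c : ℝ) (hF : SeminormCauchy N F) :
    SeminormCauchy N fun n => c • F n := by
  intro ε hε
  have hc : 0 < |c| + 1 := by positivity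
  obtain ⟨M, h⟩ := hF (ε / (|c| + 1)) (by positivity)
  refine ⟨M, fun n hn k hk => ?_⟩
  have h1 := h n hn k hk
  rw [lt_div_iff₀ hc] at h1
  rw [← smul_sub, map_smul_eq_mul, Real.norm_eq_abs]
  have := apply_nonneg N (F n - F k)
  linarith

theorem SeminormCauchy.sub {N : Seminorm ℝ V} {F G : ℕ → V} (hF : SeminormCauchy N F)
    (hG : SeminormCauchy N G) : SeminormCauchy N fun n => F n - G n := by
  simpa [sub_eq_add_neg] using hF.add (hG.smul (-1))

theorem seminormCauchy_const (N : Seminorm ℝ V) (f : V) : SeminormCauchy N fun _ => f :=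
  fun ε hε => ⟨0, fun _ _ _ _ => by simpa using hε⟩

theorem SeminormCauchy.exists_tendsto {N : Seminorm ℝ V} {F : ℕ → V} (hF : SeminormCauchy N F) :
    ∃ l : ℝ, Tendsto (fun n => N (F n)) atTop (𝓝 l) := by
  refine cauchySeq_tendsto_of_complete (Metric.cauchySeq_iff.2 fun ε hε => ?_)
  obtain ⟨M, h⟩ := hF ε hε
  refine ⟨M, fun n hn k hk => lt_of_le_of_lt ?_ (h n hn k hk)⟩
  exact abs_sub_map_le_sub N (F n) (F k)

/-- The seminorm `N` is closable with respect to the map `j`. -/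
def SeminormClosable (N : Seminorm ℝ V) (j : V →ₗ[ℝ] L) : Prop :=
  ∀ F : ℕ → V, SeminormCauchy N F → Tendsto (fun n => j (F n)) atTop (𝓝 0) →
    Tendsto (fun n => N (F n)) atTop (𝓝 0)

/-- The limits of the images under `j` of the `N`-Cauchy sequences. -/
def seminormCompletion (N : Seminorm ℝ V) (j : V →ₗ[ℝ] L) : Submodule ℝ L where
  carrier := {x | ∃ F : ℕ → V, SeminormCauchy N F ∧ Tendsto (fun n => j (F n)) atTop (𝓝 x)}
  add_mem' := by
    rintro x y ⟨F, hF, hx⟩ ⟨G, hG, hy⟩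
    exact ⟨_, hF.add hG, by simpa only [map_add] using hx.add hy⟩
  zero_mem' := ⟨_, seminormCauchy_const N 0, by simp⟩
  smul_mem' := by
    rintro c x ⟨F, hF, hx⟩
    exact ⟨_, hF.smul c, by simpa only [map_smul] using hx.const_smul c⟩

theorem mem_seminormCompletion {N : Seminorm ℝ V} {j : V →ₗ[ℝ] L} {x : L} :
    x ∈ seminormCompletion N j ↔
      ∃ F : ℕ → V, SeminormCauchy N F ∧ Tendsto (fun n => j (F n)) atTop (𝓝 x) := Iff.rfl

/-- The extension of a seminorm `N` to its completion: the limit of `N` along an approximating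
sequence. -/
noncomputable def seminormExtension (N : Seminorm ℝ V) (j : V →ₗ[ℝ] L)
    (x : seminormCompletion N j) : ℝ :=
  (mem_seminormCompletion.1 x.2).choose_spec.1.exists_tendsto.choose

variable {N : Seminorm ℝ V} {j : V →ₗ[ℝ] L}

theorem SeminormClosable.tendsto (h : SeminormClosable N j) (x : seminormCompletion N j)
    {F : ℕ → V} (hF : SeminormCauchy N F) (hx : Tendsto (fun n => j (F n)) atTop (𝓝 (x : L))) :
    Tendsto (fun n => N (F n)) atTop (𝓝 (seminormExtension N j x)) := by
  obtain ⟨G, hG, hGx, hl⟩ : ∃ G : ℕ → V, SeminormCauchy N G ∧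
      Tendsto (fun n => j (G n)) atTop (𝓝 (x : L)) ∧
      Tendsto (fun n => N (G n)) atTop (𝓝 (seminormExtension N j x)) :=
    have hs := (mem_seminormCompletion.1 x.2).choose_spec
    ⟨_, hs.1, hs.2, hs.1.exists_tendsto.choose_spec⟩
  have h0 := h _ (hF.sub hG) (by simpa only [map_sub, sub_self] using hx.sub hGx)
  have h1 : Tendsto (fun n => N (F n) - N (G n)) atTop (𝓝 0) :=
    squeeze_zero_norm (fun n => abs_sub_map_le_sub N (F n) (G n)) h0
  have h2 := h1.add hl
  simp only [sub_add_cancel, zero_add] at h2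
  exact h2

theorem SeminormClosable.extension_nonneg (h : SeminormClosable N j)
    (x : seminormCompletion N j) : 0 ≤ seminormExtension N j x := by
  obtain ⟨F, hF, hx⟩ := mem_seminormCompletion.1 x.2
  exact ge_of_tendsto' (h.tendsto x hF hx) fun n => apply_nonneg N _

theorem SeminormClosable.extension_add_le (h : SeminormClosable N j)
    (x y : seminormCompletion N j) : seminormExtension N j (x + y)
      ≤ seminormExtension N j x + seminormExtension N j y := by
  obtain ⟨F, hF, hx⟩ := mem_seminormCompletion.1 x.2
  obtain ⟨G, hG, hy⟩ := mem_seminormCompletion.1 y.2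
  have h1 := h.tendsto (x + y) (hF.add hG) (by simpa only [map_add] using! hx.add hy)
  have h2 := (h.tendsto x hF hx).add (h.tendsto y hG hy)
  exact le_of_tendsto_of_tendsto' h1 h2 fun n => map_add_le_add N _ _

/-- The completion of a closable seminorm is a Banach space with the graph norm. -/
theorem SeminormClosable.isBanachNorm [CompleteSpace L] (h : SeminormClosable N j) :
    IsBanachNorm fun x : seminormCompletion N j => ‖(x : L)‖ + seminormExtension N j x where
  nonneg x := add_nonneg (norm_nonneg _) (h.extension_nonneg x)
  eq_zero_iff x := by
    constructor
    · intro hx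
      have h1 := h.extension_nonneg x
      have h2 := norm_nonneg (x : L)
      exact Subtype.ext (norm_eq_zero.1 (by linarith))
    · rintro rfl
      have h1 := h.tendsto 0 (seminormCauchy_const N 0) (by simp)
      simp only [map_zero] at h1
      simp [tendsto_nhds_unique h1 tendsto_const_nhds]
  smul c x := by
    obtain ⟨F, hF, hx⟩ := mem_seminormCompletion.1 x.2
    have h1 := h.tendsto (c • x) (hF.smul c) (by simpa only [map_smul] using! hx.const_smul c)
    have h2 := (h.tendsto x hF hx).const_mul |c|
    simp only [map_smul_eq_mul, Real.norm_eq_abs] at h1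
    rw [tendsto_nhds_unique h1 h2, Submodule.coe_smul, norm_smul, Real.norm_eq_abs, mul_add]
  add_le x y := by
    have h1 := h.extension_add_le x y
    have h2 := norm_add_le (x : L) (y : L)
    rw [Submodule.coe_add]
    linarith
  complete u hu := by
    -- The extended seminorm of `±(x - j F_k)` becomes small along a sequence approximating `x`.
    have tail : ∀ (x : seminormCompletion N j) (F : ℕ → V), SeminormCauchy N F →
        Tendsto (fun n => j (F n)) atTop (𝓝 (x : L)) → ∀ ε : ℝ, 0 < ε → ∃ M : ℕ, ∀ k, M ≤ k →
        ∀ y : seminormCompletion N j,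
        ((y : L) = x - j (F k) ∨ (y : L) = j (F k) - x) → seminormExtension N j y ≤ ε := by
      intro x F hF hx ε hε
      obtain ⟨M, hM⟩ := hF ε hε
      refine ⟨M, fun k hk y hy => ?_⟩
      rcases hy with hy | hy
      · have h1 := h.tendsto y (hF.sub (seminormCauchy_const N (F k))) (by
          rw [hy]
          simpa only [map_sub] using hx.sub_const (j (F k)))
        refine le_of_tendsto h1 ?_
        filter_upwards [eventually_ge_atTop M] with n hn
        exact (hM n hn k hk).le
      · have h1 := h.tendsto y ((seminormCauchy_const N (F k)).sub hF) (by
          rw [hy]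
          simpa only [map_sub] using hx.const_sub (j (F k)))
        refine le_of_tendsto h1 ?_
        filter_upwards [eventually_ge_atTop M] with n hn
        exact (hM k hk n hn).le
    have hmem : ∀ f : V, j f ∈ seminormCompletion N j := fun f =>
      ⟨_, seminormCauchy_const N f, tendsto_const_nhds⟩
    -- Each `u n` is replaced by an element of `V` that is close to it in the graph norm.
    have approx : ∀ n : ℕ, ∃ f : V, ‖(u n : L) - j f‖ ≤ 1 / ((n : ℝ) + 1) ∧
        seminormExtension N j (u n - ⟨j f, hmem f⟩) ≤ 1 / ((n : ℝ) + 1) ∧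
        seminormExtension N j (⟨j f, hmem f⟩ - u n) ≤ 1 / ((n : ℝ) + 1) := by
      intro n
      have hpos : (0 : ℝ) < 1 / ((n : ℝ) + 1) := by positivity
      obtain ⟨F, hF, hx⟩ := mem_seminormCompletion.1 (u n).2
      obtain ⟨M1, hM1⟩ := tail (u n) F hF hx _ hpos
      obtain ⟨M2, hM2⟩ := Metric.tendsto_atTop.1 hx _ hpos
      refine ⟨F (max M1 M2), ?_, hM1 _ (le_max_left _ _) _ (Or.inl rfl),
        hM1 _ (le_max_left _ _) _ (Or.inr rfl)⟩
      have := hM2 (max M1 M2) (le_max_right _ _)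
      rw [dist_comm, dist_eq_norm] at this
      exact this.le
    choose f hf1 hf2 hf3 using approx
    have hNval : ∀ g : V, ∀ y : seminormCompletion N j, (y : L) = j g →
        seminormExtension N j y = N g := fun g y hy =>
      tendsto_nhds_unique (h.tendsto y (seminormCauchy_const N g) (by rw [hy]; exact
        tendsto_const_nhds)) tendsto_const_nhds
    have small : ∀ ε : ℝ, 0 < ε → ∃ M : ℕ, ∀ n, M ≤ n → 1 / ((n : ℝ) + 1) < ε := fun ε hε => by
      obtain ⟨M, hM⟩ := Metric.tendsto_atTop.1
        (tendsto_one_div_add_atTop_nhds_zero_nat (𝕜 := ℝ)) ε hε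
      refine ⟨M, fun n hn => ?_⟩
      have := hM n hn
      rw [Real.dist_eq, sub_zero] at this
      exact (le_abs_self _).trans_lt this
    have hcauN : SeminormCauchy N f := by
      intro ε hε
      obtain ⟨M1, hM1⟩ := hu (ε / 3) (by positivity)
      obtain ⟨M2, hM2⟩ := small (ε / 3) (by positivity)
      refine ⟨max M1 M2, fun n hn k hk => ?_⟩
      have h1 := hM1 n ((le_max_left _ _).trans hn) k ((le_max_left _ _).trans hk)
      have h2 := hM2 n ((le_max_right _ _).trans hn)
      have h3 := hM2 k ((le_max_right _ _).trans hk)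
      have h4 := h.extension_add_le (⟨j (f n), hmem _⟩ - u n) (u n - u k)
      have h5 := h.extension_add_le (⟨j (f n), hmem _⟩ - u n + (u n - u k)) (u k - ⟨j (f k), hmem _⟩)
      rw [hNval (f n - f k) _ (by
        simp only [Submodule.coe_add, Submodule.coe_sub, map_sub]
        abel)] at h5
      have h6 := norm_nonneg ((u n - u k : seminormCompletion N j) : L)
      linarith [hf2 k, hf3 n]
    have hcauL : CauchySeq fun n => j (f n) := by
      refine Metric.cauchySeq_iff.2 fun ε hε => ?_
      obtain ⟨M1, hM1⟩ := hu (ε / 3) (by positivity)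
      obtain ⟨M2, hM2⟩ := small (ε / 3) (by positivity)
      refine ⟨max M1 M2, fun n hn k hk => ?_⟩
      have h1 := hM1 n ((le_max_left _ _).trans hn) k ((le_max_left _ _).trans hk)
      have h2 := hM2 n ((le_max_right _ _).trans hn)
      have h3 := hM2 k ((le_max_right _ _).trans hk)
      have h4 := h.extension_nonneg (u n - u k)
      have h5 := hf1 n
      rw [norm_sub_rev] at h5
      have h6 : j (f n) - j (f k) = (j (f n) - u n) + ((u n - u k : seminormCompletion N j) : L)
          + (u k - j (f k)) := by
        rw [Submodule.coe_sub]
        abel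
      rw [dist_eq_norm, h6]
      have h7 := norm_add₃_le (a := j (f n) - (u n : L))
        (b := ((u n - u k : seminormCompletion N j) : L)) (c := (u k : L) - j (f k))
      linarith [hf1 k]
    obtain ⟨x, hx⟩ := cauchySeq_tendsto_of_complete hcauL
    let v : seminormCompletion N j := ⟨x, f, hcauN, hx⟩
    refine ⟨v, Metric.tendsto_atTop.2 fun ε hε => ?_⟩
    obtain ⟨M1, hM1⟩ := tail v f hcauN hx (ε / 5) (by positivity)
    obtain ⟨M2, hM2⟩ := small (ε / 5) (by positivity)
    obtain ⟨M3, hM3⟩ := Metric.tendsto_atTop.1 hx (ε / 5) (by positivity)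
    refine ⟨max M1 (max M2 M3), fun n hn => ?_⟩
    have h1 := hM1 n ((le_max_left _ _).trans hn) (⟨j (f n), hmem _⟩ - v) (Or.inr rfl)
    have h2 := hM2 n (((le_max_left _ _).trans (le_max_right _ _)).trans hn)
    have h3 := hM3 n (((le_max_right _ _).trans (le_max_right _ _)).trans hn)
    have h4 := h.extension_add_le (u n - ⟨j (f n), hmem _⟩) (⟨j (f n), hmem _⟩ - v)
    rw [sub_add_sub_cancel] at h4
    rw [dist_eq_norm] at h3
    have h5 := norm_sub_le_norm_sub_add_norm_sub (u n : L) (j (f n)) x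
    have h6 : ((u n - v : seminormCompletion N j) : L) = u n - x := rfl
    rw [Real.dist_eq, sub_zero, abs_of_nonneg (add_nonneg (norm_nonneg _) (h.extension_nonneg _)),
      h6]
    linarith [hf1 n, hf2 n]

end ClosableSeminorm

end DirichletForm

/-! ### The `p`-energy as a seminorm -/

namespace DirichletForm

section PEnergy

theorem memLp_top_sqrt {X : Type*} [MeasurableSpace X] {m : Measure X} [IsFiniteMeasure m]
    {g : X → ℝ} (hg : MemLp g ∞ m) : MemLp (fun x => √(g x)) ∞ m := by
  refine ((memLp_const (1 : ℝ)).add hg.norm).mono'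
    (Real.continuous_sqrt.comp_aestronglyMeasurable hg.1) (Eventually.of_forall fun x => ?_)
  rw [Real.norm_of_nonneg (Real.sqrt_nonneg _), Pi.add_apply, Real.norm_eq_abs]
  refine Real.sqrt_le_iff.2 ⟨by positivity, ?_⟩
  nlinarith [le_abs_self (g x), abs_nonneg (g x)]

variable {X : Type*} [MetricSpace X] [LocallyCompactSpace X] [SecondCountableTopology X]
  [MeasurableSpace X] [BorelSpace X] {m : Measure X} [IsFiniteMeasure m] {E : DirichletForm m}
  {A : NonUnitalSubalgebra ℝ C_c(X, ℝ)}

/-- The length `√Γ(u, u)` of the gradient of `u`. -/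
noncomputable def StandingAssumption.grad (hE : E.StandingAssumption A) (u : E.FormDomain) (x : X) :
    ℝ :=
  √(hE.gamma u u x)

theorem StandingAssumption.grad_nonneg (hE : E.StandingAssumption A) (u : E.FormDomain) (x : X) :
    0 ≤ hE.grad u x := Real.sqrt_nonneg _

theorem StandingAssumption.aestronglyMeasurable_grad (hE : E.StandingAssumption A)
    (u : E.FormDomain) : AEStronglyMeasurable (hE.grad u) m :=
  Real.continuous_sqrt.comp_aestronglyMeasurable (Lp.aestronglyMeasurable _)

theorem StandingAssumption.grad_sq (hE : E.StandingAssumption A) (u : E.FormDomain) :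
    ∀ᵐ x ∂m, hE.grad u x ^ 2 = hE.gamma u u x := by
  filter_upwards [hE.gamma_self_nonneg u] with x hx
  exact Real.sq_sqrt hx

theorem StandingAssumption.abs_gamma_le (hE : E.StandingAssumption A) (u v : E.FormDomain) :
    ∀ᵐ x ∂m, |hE.gamma u v x| ≤ hE.grad u x * hE.grad v x :=
  ae_abs_bilin_le hE.gamma_symm hE.gamma_self_nonneg u v

theorem StandingAssumption.grad_add_le (hE : E.StandingAssumption A) (u v : E.FormDomain) :
    ∀ᵐ x ∂m, hE.grad (u + v) x ≤ hE.grad u x + hE.grad v x :=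
  ae_sqrt_bilin_add_le hE.gamma_symm hE.gamma_self_nonneg u v

theorem StandingAssumption.abs_grad_sub_grad_le (hE : E.StandingAssumption A)
    (u v : E.FormDomain) : ∀ᵐ x ∂m, |hE.grad u x - hE.grad v x| ≤ hE.grad (u - v) x :=
  ae_abs_sqrt_bilin_sub_le hE.gamma_symm hE.gamma_self_nonneg u v

theorem StandingAssumption.grad_neg (hE : E.StandingAssumption A) (u : E.FormDomain) (x : X) :
    hE.grad (-u) x = hE.grad u x := by
  rw [grad, bilin_neg_neg, grad]

theorem StandingAssumption.grad_zero (hE : E.StandingAssumption A) :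
    ∀ᵐ x ∂m, hE.grad 0 x = 0 := by
  have h : hE.gamma 0 0 = 0 := map_zero _
  filter_upwards [Lp.coeFn_zero ℝ 1 m] with x hx
  rw [grad, h, hx, Pi.zero_apply, Real.sqrt_zero]

theorem StandingAssumption.grad_smul (hE : E.StandingAssumption A) (c : ℝ) (u : E.FormDomain) :
    hE.grad (c • u) =ᵐ[m] |c| • hE.grad u := by
  have e : hE.gamma (c • u) (c • u) = (c ^ 2) • hE.gamma u u := by
    simp only [map_smul, LinearMap.smul_apply, smul_smul, sq]
  filter_upwards [Lp.coeFn_smul (c ^ 2) (hE.gamma u u)] with x hx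
  rw [grad, e, hx, Pi.smul_apply, Pi.smul_apply, smul_eq_mul, Real.sqrt_mul (sq_nonneg c),
    Real.sqrt_sq_eq_abs, smul_eq_mul, grad]

theorem StandingAssumption.memLp_two_grad (hE : E.StandingAssumption A) (u : E.FormDomain) :
    MemLp (hE.grad u) 2 m := by
  rw [memLp_two_iff_integrable_sq (hE.aestronglyMeasurable_grad u)]
  refine (L1.integrable_coeFn (hE.gamma u u)).congr ?_
  filter_upwards [hE.grad_sq u] with x hx
  exact hx.symm

theorem StandingAssumption.toReal_eLpNorm_grad_two (hE : E.StandingAssumption A)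
    (u : E.FormDomain) : (eLpNorm (hE.grad u) 2 m).toReal = √(E.energy u u) := by
  rw [(hE.memLp_two_grad u).eLpNorm_eq_integral_rpow_norm two_ne_zero ENNReal.ofNat_ne_top,
    ENNReal.toReal_ofReal (by positivity), ENNReal.toReal_ofNat, Real.sqrt_eq_rpow, one_div]
  congr 1
  rw [← hE.norm_gamma_self, norm_bilin_self hE.gamma_self_nonneg]
  refine integral_congr_ae ?_
  filter_upwards [hE.grad_sq u] with x hx
  rw [← hx, Real.rpow_two, Real.norm_eq_abs, sq_abs]

/-- The algebra `A` as a subspace of `C_c(X) ∩ 𝒟(ℰ)`. -/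
def coreDomain (E : DirichletForm m) (A : NonUnitalSubalgebra ℝ C_c(X, ℝ)) :
    Submodule ℝ E.ContDomain where
  carrier := {f | f.1 ∈ A}
  add_mem' := fun hf hg => A.add_mem hf hg
  zero_mem' := A.zero_mem
  smul_mem' := fun c _ hf => A.toSubmodule.smul_mem c hf

/-- An element of the algebra `A` as an element of `coreDomain`. -/
def StandingAssumption.toCore (hE : E.StandingAssumption A) (f : C_c(X, ℝ)) (hf : f ∈ A) :
    E.coreDomain A :=
  ⟨.mk f (hE.core.inDom f hf), hf⟩

/-- The length of the gradient of an element of the algebra `A`. -/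
noncomputable def StandingAssumption.coreGrad (hE : E.StandingAssumption A)
    (f : E.coreDomain A) : X → ℝ := hE.grad (E.ofCont f)

theorem StandingAssumption.coreGrad_def (hE : E.StandingAssumption A)
    (f : E.coreDomain A) : hE.coreGrad f = hE.grad (E.ofCont f) := rfl

theorem StandingAssumption.memLp_top_coreGrad (hE : E.StandingAssumption A)
    (f : E.coreDomain A) : MemLp (hE.coreGrad f) ∞ m := by
  refine memLp_top_sqrt ?_
  rw [hE.gamma_ofCont]
  exact hE.bounded _ f.2 _ f.2

theorem StandingAssumption.memLp_coreGrad (hE : E.StandingAssumption A) (f : E.coreDomain A)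
    (q : ℝ≥0∞) : MemLp (hE.coreGrad f) q m :=
  (hE.memLp_top_coreGrad f).mono_exponent le_top

/-- The seminorm `ℰ^(p)(·)^(1/p)` on the algebra `A`. -/
noncomputable def StandingAssumption.pSeminorm (hE : E.StandingAssumption A) {p : ℝ}
    (hp : 1 ≤ p) : Seminorm ℝ (E.coreDomain A) :=
  Seminorm.of (fun f => (eLpNorm (hE.coreGrad f) (ENNReal.ofReal p) m).toReal)
    (fun f g => by
      have hp' : 1 ≤ ENNReal.ofReal p := by
        rw [← ENNReal.ofReal_one]
        exact ENNReal.ofReal_le_ofReal hp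
      have hf := hE.memLp_coreGrad f (ENNReal.ofReal p)
      have hg := hE.memLp_coreGrad g (ENNReal.ofReal p)
      rw [← ENNReal.toReal_add hf.2.ne hg.2.ne]
      refine ENNReal.toReal_mono (ENNReal.add_ne_top.2 ⟨hf.2.ne, hg.2.ne⟩) ?_
      refine le_trans (eLpNorm_mono_ae_real ?_) (eLpNorm_add_le hf.1 hg.1 hp')
      filter_upwards [hE.grad_add_le (E.ofCont f) (E.ofCont g)] with x hx
      rw [coreGrad_def, Real.norm_of_nonneg (hE.grad_nonneg _ _), Submodule.coe_add, map_add]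
      exact hx)
    (fun c f => by
      rw [coreGrad_def, Submodule.coe_smul, map_smul, eLpNorm_congr_ae (hE.grad_smul c _),
        eLpNorm_const_smul, ENNReal.toReal_mul, coreGrad_def]
      simp)

theorem StandingAssumption.pSeminorm_apply (hE : E.StandingAssumption A) {p : ℝ}
    (hp : 1 ≤ p) (f : E.coreDomain A) :
    hE.pSeminorm hp f = (eLpNorm (hE.coreGrad f) (ENNReal.ofReal p) m).toReal := rfl

theorem StandingAssumption.pEnergy_rpow (hE : E.StandingAssumption A) {p : ℝ}
    (hp : 1 ≤ p) (f : E.coreDomain A) :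
    E.pEnergy p f.1.1 ^ (1 / p) = hE.pSeminorm hp f := by
  have hp0 : 0 < p := one_pos.trans_le hp
  have hint : 0 ≤ ∫ x, ‖hE.coreGrad f x‖ ^ p ∂m := integral_nonneg fun x => by positivity
  rw [pSeminorm_apply, (hE.memLp_coreGrad f _).eLpNorm_eq_integral_rpow_norm
    (by simpa using hp0) ENNReal.ofReal_ne_top, ENNReal.toReal_ofReal hp0.le,
    ENNReal.toReal_ofReal (by positivity), one_div, pEnergy]
  congr 1
  refine integral_congr_ae ?_
  filter_upwards [hE.gamma_self_nonneg (E.ofCont f)] with x hx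
  rw [coreGrad_def, Real.norm_of_nonneg (hE.grad_nonneg _ _), grad, Real.sqrt_eq_rpow,
    ← Real.rpow_mul hx, hE.gamma_ofCont]
  congr 1
  ring

theorem StandingAssumption.pEnergy_eq (hE : E.StandingAssumption A) {p : ℝ}
    (hp : 1 ≤ p) (f : E.coreDomain A) : E.pEnergy p f.1.1 = hE.pSeminorm hp f ^ p := by
  have hp0 : 0 < p := one_pos.trans_le hp
  have h0 : 0 ≤ E.pEnergy p f.1.1 := by
    refine integral_nonneg_of_ae ?_
    filter_upwards [hE.contGamma_self_nonneg f.1] with x hx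
    exact Real.rpow_nonneg hx _
  rw [← hE.pEnergy_rpow hp, ← Real.rpow_mul h0, one_div_mul_cancel hp0.ne', Real.rpow_one]

theorem memLp_compactlySupported (f : C_c(X, ℝ)) (q : ℝ≥0∞) : MemLp f q m :=
  f.continuous.memLp_of_hasCompactSupport f.hasCompactSupport

/-- The map sending an element of the algebra `A` to its class in `L^q(X, m)`. -/
noncomputable def coreToLp (E : DirichletForm m) (A : NonUnitalSubalgebra ℝ C_c(X, ℝ))
    (q : ℝ≥0∞) : E.coreDomain A →ₗ[ℝ] Lp ℝ q m where
  toFun f := (memLp_compactlySupported f.1.1 q).toLp _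
  map_add' _ _ := rfl
  map_smul' _ _ := rfl

theorem tendsto_coreToLp_iff {q : ℝ≥0∞} [Fact (1 ≤ q)] {F : ℕ → E.coreDomain A}
    {f : Lp ℝ q m} {f' : X → ℝ} (hf : f =ᵐ[m] f') :
    Tendsto (fun n => E.coreToLp A q (F n)) atTop (𝓝 f) ↔
      Tendsto (fun n => eLpNorm (fun x => (F n).1.1 x - f' x) q m) atTop (𝓝 0) := by
  rw [Lp.tendsto_Lp_iff_tendsto_eLpNorm']
  refine tendsto_congr fun n => eLpNorm_congr_ae ?_
  filter_upwards [hf, MemLp.coeFn_toLp (memLp_compactlySupported (m := m) (F n).1.1 q)]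
    with x h1 h2
  rw [Pi.sub_apply, h1, ← h2]
  rfl

theorem StandingAssumption.approximates_iff (hE : E.StandingAssumption A) {p : ℝ} (hp : 1 ≤ p)
    [Fact (1 ≤ ENNReal.ofReal p)] {F : ℕ → C_c(X, ℝ)} {f : Lp ℝ (ENNReal.ofReal p) m} {f' : X → ℝ}
    (hf : f =ᵐ[m] f') :
    E.Approximates A p F f' ↔ ∃ G : ℕ → E.coreDomain A, (∀ n, (G n).1.1 = F n) ∧
      SeminormCauchy (hE.pSeminorm hp) G ∧
      Tendsto (fun n => E.coreToLp A (ENNReal.ofReal p) (G n)) atTop (𝓝 f) := by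
  constructor
  · rintro ⟨h1, h2, h3⟩
    refine ⟨fun n => hE.toCore (F n) (h1 n), fun n => rfl, fun ε hε => ?_, ?_⟩
    · obtain ⟨N, hN⟩ := h2 ε hε
      refine ⟨N, fun n hn k hk => ?_⟩
      rw [← hE.pEnergy_rpow]
      exact hN n hn k hk
    · rw [tendsto_coreToLp_iff hf]
      exact h3
  · rintro ⟨G, hG, h2, h3⟩
    obtain rfl : F = fun n => (G n).1.1 := funext fun n => (hG n).symm
    refine ⟨fun n => (G n).2, fun ε hε => ?_, (tendsto_coreToLp_iff hf).1 h3⟩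
    obtain ⟨N, hN⟩ := h2 ε hε
    refine ⟨N, fun n hn k hk => ?_⟩
    have := hN n hn k hk
    rw [← hE.pEnergy_rpow] at this
    exact this

/-- Closability of the seminorm `ℰ^(p)(·)^(1/p)` gives closability of the functional `ℰ^(p)` and
the Banach space `H_0^{1,p}`. -/
theorem StandingAssumption.isPClosable_and_sobolevSpaceIsBanach (hE : E.StandingAssumption A)
    {p : ℝ} (hp : 1 ≤ p) [Fact (1 ≤ ENNReal.ofReal p)]
    (h : SeminormClosable (hE.pSeminorm hp) (E.coreToLp A (ENNReal.ofReal p))) :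
    E.IsPClosable A p ∧ E.SobolevSpaceIsBanach A p := by
  have hp0 : 0 < p := one_pos.trans_le hp
  constructor
  · intro F hF
    obtain ⟨G, hG, h2, h3⟩ := (hE.approximates_iff hp (Lp.coeFn_zero ℝ _ m)).1 hF
    have h4 := (h G h2 h3).rpow_const (p := p) (Or.inr hp0.le)
    rw [Real.zero_rpow hp0.ne'] at h4
    refine h4.congr fun n => ?_
    rw [← hE.pEnergy_eq hp, hG]
  · refine ⟨seminormCompletion (hE.pSeminorm hp) (E.coreToLp A (ENNReal.ofReal p)),
      fun f => seminormExtension _ _ f ^ p, ?_, ?_, ?_⟩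
    · ext f
      constructor
      · rintro ⟨G, h2, h3⟩
        exact ⟨fun n => (G n).1.1,
          (hE.approximates_iff hp (ae_eq_refl _)).2 ⟨G, fun _ => rfl, h2, h3⟩⟩
      · rintro ⟨F, hF⟩
        obtain ⟨G, -, h2, h3⟩ := (hE.approximates_iff hp (ae_eq_refl _)).1 hF
        exact ⟨G, h2, h3⟩
    · intro f F hF
      obtain ⟨G, hG, h2, h3⟩ := (hE.approximates_iff hp (ae_eq_refl _)).1 hF
      refine ((h.tendsto f h2 h3).rpow_const (p := p) (Or.inr hp0.le)).congr fun n => ?_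
      rw [← hE.pEnergy_eq hp, hG]
    · have h1 := h.isBanachNorm
      have e : ∀ f : seminormCompletion (hE.pSeminorm hp) (E.coreToLp A (ENNReal.ofReal p)),
          (seminormExtension (hE.pSeminorm hp) (E.coreToLp A (ENNReal.ofReal p)) f ^ p) ^ (1 / p)
            = seminormExtension (hE.pSeminorm hp) (E.coreToLp A (ENNReal.ofReal p)) f := fun f => by
        rw [← Real.rpow_mul (h.extension_nonneg f), mul_one_div_cancel hp0.ne', Real.rpow_one]
      simp only [e]
      exact h1

/-! ### Closability for `p ≥ 2` -/

theorem StandingAssumption.eLpNorm_coreGrad_sub_le (hE : E.StandingAssumption A)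
    (f g : E.coreDomain A) (q : ℝ≥0∞) :
    eLpNorm (hE.coreGrad f - hE.coreGrad g) q m ≤ eLpNorm (hE.coreGrad (f - g)) q m := by
  refine eLpNorm_mono_ae_real ?_
  filter_upwards [hE.abs_grad_sub_grad_le (E.ofCont f) (E.ofCont g)] with x hx
  rw [coreGrad_def, coreGrad_def, coreGrad_def, Submodule.coe_sub, map_sub]
  exact hx

/-- The lengths of the gradients along a Cauchy sequence converge in `L^p(X, m)`. Hence it suffices
to identify the limit along a subsequence. -/
theorem StandingAssumption.tendsto_pSeminorm_of_subseq (hE : E.StandingAssumption A) {p : ℝ}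
    (hp : 1 ≤ p) [Fact (1 ≤ ENNReal.ofReal p)] {F : ℕ → E.coreDomain A}
    (hF : SeminormCauchy (hE.pSeminorm hp) F) {ns : ℕ → ℕ} (hns : StrictMono ns)
    (h : ∀ᵐ x ∂m, Tendsto (fun k => hE.coreGrad (F (ns k)) x) atTop (𝓝 0)) :
    Tendsto (fun n => hE.pSeminorm hp (F n)) atTop (𝓝 0) := by
  let S : ℕ → Lp ℝ (ENNReal.ofReal p) m := fun n => (hE.memLp_coreGrad (F n) _).toLp _
  have hS : CauchySeq S := by
    refine Metric.cauchySeq_iff.2 fun ε hε => ?_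
    obtain ⟨M, hM⟩ := hF ε hε
    refine ⟨M, fun n hn k hk => lt_of_le_of_lt ?_ (hM n hn k hk)⟩
    rw [dist_eq_norm, ← MemLp.toLp_sub, Lp.norm_toLp, pSeminorm_apply]
    exact ENNReal.toReal_mono (hE.memLp_coreGrad _ _).2.ne (hE.eLpNorm_coreGrad_sub_le _ _ _)
  obtain ⟨s, hs⟩ := cauchySeq_tendsto_of_complete hS
  have h1 := tendstoInMeasure_of_tendsto_Lp (hs.comp hns.tendsto_atTop)
  obtain ⟨ks, hks, h2⟩ := h1.exists_seq_tendsto_ae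
  have h3 : ∀ᵐ x ∂m, ∀ n, S n x = hE.coreGrad (F n) x :=
    ae_all_iff.2 fun n => MemLp.coeFn_toLp _
  have hs0 : s = 0 := by
    refine Lp.ext ?_
    filter_upwards [h, h2, h3, Lp.coeFn_zero ℝ (ENNReal.ofReal p) m] with x hx1 hx2 hx3 hx4
    rw [hx4, Pi.zero_apply]
    refine tendsto_nhds_unique hx2 ?_
    simp only [Function.comp_apply, hx3]
    exact hx1.comp hks.tendsto_atTop
  rw [hs0] at hs
  have h4 := hs.norm
  rw [norm_zero] at h4
  refine h4.congr fun n => ?_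
  rw [Lp.norm_toLp, pSeminorm_apply]

theorem StandingAssumption.norm_ofCont_sq (hE : E.StandingAssumption A) (f : E.coreDomain A) :
    ‖E.ofCont f‖ ^ 2 = (eLpNorm (hE.coreGrad f) 2 m).toReal ^ 2
      + ‖E.coreToLp A 2 f‖ ^ 2 := by
  rw [formDomain_norm_sq', coreGrad_def, hE.toReal_eLpNorm_grad_two,
    Real.sq_sqrt (E.energy_nonneg _)]
  rfl

theorem StandingAssumption.seminormClosable_of_two_le (hE : E.StandingAssumption A) {p : ℝ}
    (hp : 1 ≤ p) (hp2 : 2 ≤ p) [Fact (1 ≤ ENNReal.ofReal p)] :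
    SeminormClosable (hE.pSeminorm hp) (E.coreToLp A (ENNReal.ofReal p)) := by
  intro F hF hF0
  have hp2' : (2 : ℝ≥0∞) ≤ ENNReal.ofReal p := by
    rw [← ENNReal.ofReal_ofNat]
    exact ENNReal.ofReal_le_ofReal hp2
  obtain ⟨C, hC⟩ : ∃ C : ℝ, 0 < C ∧ ∀ g : X → ℝ, MemLp g (ENNReal.ofReal p) m →
      (eLpNorm g 2 m).toReal ≤ (eLpNorm g (ENNReal.ofReal p) m).toReal * C := by
    set c := m Set.univ ^ (1 / (2 : ℝ≥0∞).toReal - 1 / (ENNReal.ofReal p).toReal) with hc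
    have hexp : 0 ≤ 1 / (2 : ℝ≥0∞).toReal - 1 / (ENNReal.ofReal p).toReal := by
      rw [ENNReal.toReal_ofReal (by linarith), ENNReal.toReal_ofNat, sub_nonneg]
      exact one_div_le_one_div_of_le two_pos hp2
    have hct : c ≠ ∞ := ENNReal.rpow_ne_top_of_nonneg hexp (measure_ne_top _ _)
    refine ⟨c.toReal + 1, by positivity, fun g hg => ?_⟩
    have h1 := eLpNorm_le_eLpNorm_mul_rpow_measure_univ hp2' hg.1
    have h2 := ENNReal.toReal_mono (ENNReal.mul_ne_top hg.2.ne hct) h1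
    rw [ENNReal.toReal_mul] at h2
    have : 0 ≤ (eLpNorm g (ENNReal.ofReal p) m).toReal := ENNReal.toReal_nonneg
    linarith
  have hL2 : Tendsto (fun n => E.coreToLp A 2 (F n)) atTop (𝓝 0) := by
    rw [tendsto_zero_iff_norm_tendsto_zero] at hF0 ⊢
    have h0 := hF0.mul_const C
    rw [zero_mul] at h0
    refine squeeze_zero (fun _ => norm_nonneg _) (fun n => ?_) h0
    have := hC.2 _ (memLp_compactlySupported (m := m) (F n).1.1 (ENNReal.ofReal p))
    change ‖(memLp_compactlySupported (F n).1.1 2).toLp _‖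
      ≤ ‖(memLp_compactlySupported (F n).1.1 _).toLp _‖ * C
    rwa [Lp.norm_toLp, Lp.norm_toLp]
  have hcau : CauchySeq fun n => E.ofCont (F n : E.ContDomain) := by
    refine Metric.cauchySeq_iff.2 fun ε hε => ?_
    obtain ⟨M1, hM1⟩ := hF (ε / (2 * C)) (by have := hC.1; positivity)
    obtain ⟨M2, hM2⟩ := Metric.cauchySeq_iff.1 hL2.cauchySeq (ε / 2) (by positivity)
    refine ⟨max M1 M2, fun n hn k hk => ?_⟩
    have h1 := hM1 n ((le_max_left _ _).trans hn) k ((le_max_left _ _).trans hk)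
    have h2 := hM2 n ((le_max_right _ _).trans hn) k ((le_max_right _ _).trans hk)
    have h3 := hC.2 _ (hE.memLp_coreGrad (F n - F k) (ENNReal.ofReal p))
    rw [pSeminorm_apply, lt_div_iff₀ (by have := hC.1; positivity)] at h1
    rw [dist_eq_norm, ← map_sub] at h2
    have h4 : (eLpNorm (hE.coreGrad (F n - F k)) 2 m).toReal < ε / 2 := by linarith
    have h5 : (eLpNorm (hE.coreGrad (F n - F k)) 2 m).toReal ^ 2 < (ε / 2) ^ 2 :=
      pow_lt_pow_left₀ h4 ENNReal.toReal_nonneg two_ne_zero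
    have h6 : ‖E.coreToLp A 2 (F n - F k)‖ ^ 2 < (ε / 2) ^ 2 :=
      pow_lt_pow_left₀ h2 (norm_nonneg _) two_ne_zero
    have h7 := hE.norm_ofCont_sq (F n - F k)
    rw [dist_eq_norm, ← map_sub, ← Submodule.coe_sub]
    refine lt_of_pow_lt_pow_left₀ 2 hε.le ?_
    nlinarith [sq_nonneg ε]
  obtain ⟨v, hv⟩ := cauchySeq_tendsto_of_complete hcau
  have hv0 : v = 0 := by
    refine E.incl_injective ?_
    rw [map_zero]
    exact tendsto_nhds_unique ((E.incl.continuous.tendsto v).comp hv) hL2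
  rw [hv0, tendsto_zero_iff_norm_tendsto_zero] at hv
  have hgrad : Tendsto (fun n => eLpNorm (hE.coreGrad (F n) - fun _ => 0) 2 m) atTop (𝓝 0) := by
    have h1 : ∀ n, eLpNorm (hE.coreGrad (F n) - fun _ => 0) 2 m
        ≤ ENNReal.ofReal ‖E.ofCont (F n : E.ContDomain)‖ := fun n => by
      have h2 : (hE.coreGrad (F n) - fun _ => 0) = hE.coreGrad (F n) := by
        ext x
        simp
      rw [h2, ← ENNReal.ofReal_toReal (hE.memLp_coreGrad (F n) 2).2.ne]
      refine ENNReal.ofReal_le_ofReal (le_of_sq_le_sq ?_ (norm_nonneg _))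
      rw [hE.norm_ofCont_sq]
      linarith [sq_nonneg ‖E.coreToLp A 2 (F n)‖]
    have h3 := ENNReal.tendsto_ofReal hv
    rw [ENNReal.ofReal_zero] at h3
    exact tendsto_of_tendsto_of_tendsto_of_le_of_le tendsto_const_nhds h3 (fun _ => bot_le) h1
  obtain ⟨ns, hns, h⟩ := (tendstoInMeasure_of_tendsto_eLpNorm two_ne_zero
    (fun n => (hE.memLp_coreGrad (F n) 2).1) aestronglyMeasurable_const hgrad).exists_seq_tendsto_ae
  exact hE.tendsto_pSeminorm_of_subseq hp hF hns h

end PEnergy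

end DirichletForm

/-! ### Closability under the assumption on the generator -/

namespace DirichletForm

section GeneratorCase

variable {X : Type*} [MetricSpace X] [LocallyCompactSpace X] [SecondCountableTopology X]
  [MeasurableSpace X] [BorelSpace X] {m : Measure X} [IsFiniteMeasure m] {E : DirichletForm m}
  {A : NonUnitalSubalgebra ℝ C_c(X, ℝ)}

theorem StandingAssumption.grad_sub_comm (hE : E.StandingAssumption A) (u v : E.FormDomain)
    (x : X) : hE.grad (u - v) x = hE.grad (v - u) x := by
  rw [← neg_sub, hE.grad_neg]

theorem StandingAssumption.gamma_sub_right (hE : E.StandingAssumption A)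
    (u v w : E.FormDomain) :
    hE.gamma u (v - w) =ᵐ[m] fun x => hE.gamma u v x - hE.gamma u w x := by
  rw [map_sub]
  exact Lp.coeFn_sub _ _

theorem StandingAssumption.exists_subseq_grad_sub_tendsto (hE : E.StandingAssumption A)
    {v : ℕ → E.FormDomain} {u : E.FormDomain} (hv : Tendsto v atTop (𝓝 u)) :
    ∃ ns : ℕ → ℕ, ∀ᵐ x ∂m, Tendsto (fun k => hE.grad (u - v (ns k)) x) atTop (𝓝 0) := by
  rw [tendsto_iff_norm_sub_tendsto_zero] at hv
  have h : Tendsto (fun n => eLpNorm (hE.grad (u - v n) - fun _ => 0) 2 m) atTop (𝓝 0) := by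
    have h1 : ∀ n, eLpNorm (hE.grad (u - v n) - fun _ => 0) 2 m
        ≤ ENNReal.ofReal ‖v n - u‖ := fun n => by
      have h2 : (hE.grad (u - v n) - fun _ => 0) = hE.grad (u - v n) := by
        ext x
        simp
      rw [h2, ← ENNReal.ofReal_toReal (hE.memLp_two_grad (u - v n)).2.ne,
        hE.toReal_eLpNorm_grad_two, norm_sub_rev]
      exact ENNReal.ofReal_le_ofReal
        (Real.sqrt_le_iff.2 ⟨norm_nonneg _, E.energy_le_norm_sq _⟩)
    have h3 := ENNReal.tendsto_ofReal hv
    rw [ENNReal.ofReal_zero] at h3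
    exact tendsto_of_tendsto_of_tendsto_of_le_of_le tendsto_const_nhds h3 (fun _ => bot_le) h1
  obtain ⟨ns, -, hns⟩ := (tendstoInMeasure_of_tendsto_eLpNorm two_ne_zero
    (fun n => hE.aestronglyMeasurable_grad _) aestronglyMeasurable_const h).exists_seq_tendsto_ae
  exact ⟨ns, hns⟩

/-- If the gradients of `U i` are a pointwise Cauchy sequence and converge weakly to zero when
tested with the gradients of a dense set of functions, then they converge to zero: the weak
convergence extends to all test functions, in particular to the `U k` themselves. -/
theorem StandingAssumption.tendsto_grad_of_weak (hE : E.StandingAssumption A)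
    {U : ℕ → E.FormDomain} {D : Set E.FormDomain} (hD : Dense D)
    (hU : ∀ᵐ x ∂m, ∀ ε : ℝ, 0 < ε → ∃ M : ℕ, ∀ i, M ≤ i → ∀ j, M ≤ j →
      hE.grad (U i - U j) x ≤ ε)
    (hw : ∀ v ∈ D, ∀ᵐ x ∂m, Tendsto (fun i => hE.gamma (U i) v x) atTop (𝓝 0)) :
    ∀ᵐ x ∂m, Tendsto (fun i => hE.grad (U i) x) atTop (𝓝 0) := by
  have hbdd : ∀ᵐ x ∂m, ∃ B : ℝ, 0 < B ∧ ∀ᶠ i in atTop, hE.grad (U i) x ≤ B := by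
    have h1 : ∀ᵐ x ∂m, ∀ i j, |hE.grad (U i) x - hE.grad (U j) x| ≤ hE.grad (U i - U j) x :=
      ae_all_iff.2 fun i => ae_all_iff.2 fun j => hE.abs_grad_sub_grad_le _ _
    filter_upwards [hU, h1] with x hx h1
    obtain ⟨M, hM⟩ := hx 1 one_pos
    refine ⟨hE.grad (U M) x + 1, by have := hE.grad_nonneg (U M) x; positivity, ?_⟩
    filter_upwards [eventually_ge_atTop M] with i hi
    have h2 := hM i hi M le_rfl
    have h3 := (abs_le.1 (h1 i M)).2
    linarith
  have weak : ∀ u : E.FormDomain, ∀ᵐ x ∂m,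
      Tendsto (fun i => hE.gamma (U i) u x) atTop (𝓝 0) := by
    intro u
    obtain ⟨v, hvD, hv⟩ := mem_closure_iff_seq_limit.1 (hD u)
    obtain ⟨ns, hns⟩ := hE.exists_subseq_grad_sub_tendsto hv
    have h1 : ∀ᵐ x ∂m, ∀ k, Tendsto (fun i => hE.gamma (U i) (v (ns k)) x) atTop (𝓝 0) :=
      ae_all_iff.2 fun k => hw _ (hvD _)
    have h2 : ∀ᵐ x ∂m, ∀ i k, hE.gamma (U i) (u - v (ns k)) x
        = hE.gamma (U i) u x - hE.gamma (U i) (v (ns k)) x :=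
      ae_all_iff.2 fun i => ae_all_iff.2 fun k => hE.gamma_sub_right _ _ _
    have h3 : ∀ᵐ x ∂m, ∀ i k, |hE.gamma (U i) (u - v (ns k)) x|
        ≤ hE.grad (U i) x * hE.grad (u - v (ns k)) x :=
      ae_all_iff.2 fun i => ae_all_iff.2 fun k => hE.abs_gamma_le _ _
    filter_upwards [hbdd, hns, h1, h2, h3] with x hB hx0 hx1 hx2 hx3
    obtain ⟨B, hB0, hB⟩ := hB
    refine Metric.tendsto_atTop'.2 fun ε hε => ?_
    obtain ⟨k, hk⟩ := (Metric.tendsto_atTop.1 hx0 (ε / (2 * B)) (by positivity))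
    have hk := hk k le_rfl
    rw [Real.dist_eq, sub_zero, abs_of_nonneg (hE.grad_nonneg _ _),
      lt_div_iff₀ (by positivity)] at hk
    have hk2 := (Metric.tendsto_nhds.1 (hx1 k)) (ε / 2) (by positivity)
    obtain ⟨N, hN⟩ := eventually_atTop.1 (hB.and hk2)
    refine ⟨N, fun i hi => ?_⟩
    obtain ⟨h4, h5⟩ := hN i hi.le
    rw [Real.dist_eq, sub_zero] at h5 ⊢
    have h6 := hx3 i k
    rw [hx2 i k] at h6
    have h7 : hE.grad (U i) x * hE.grad (u - v (ns k)) x ≤ B * hE.grad (u - v (ns k)) x :=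
      mul_le_mul_of_nonneg_right h4 (hE.grad_nonneg _ _)
    have h8 := abs_sub_abs_le_abs_sub (hE.gamma (U i) u x) (hE.gamma (U i) (v (ns k)) x)
    linarith
  have h1 : ∀ᵐ x ∂m, ∀ k, Tendsto (fun i => hE.gamma (U i) (U k) x) atTop (𝓝 0) :=
    ae_all_iff.2 fun k => weak (U k)
  have h2 : ∀ᵐ x ∂m, ∀ i k, hE.gamma (U i) (U i - U k) x
      = hE.gamma (U i) (U i) x - hE.gamma (U i) (U k) x :=
    ae_all_iff.2 fun i => ae_all_iff.2 fun k => hE.gamma_sub_right _ _ _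
  have h3 : ∀ᵐ x ∂m, ∀ i k, |hE.gamma (U i) (U i - U k) x|
      ≤ hE.grad (U i) x * hE.grad (U i - U k) x :=
    ae_all_iff.2 fun i => ae_all_iff.2 fun k => hE.abs_gamma_le _ _
  have h4 : ∀ᵐ x ∂m, ∀ i, hE.grad (U i) x ^ 2 = hE.gamma (U i) (U i) x :=
    ae_all_iff.2 fun i => hE.grad_sq _
  filter_upwards [hbdd, hU, h1, h2, h3, h4] with x hB hx0 hx1 hx2 hx3 hx4
  obtain ⟨B, hB0, hB⟩ := hB
  have hsq : Tendsto (fun i => hE.grad (U i) x ^ 2) atTop (𝓝 0) := by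
    refine Metric.tendsto_atTop.2 fun ε hε => ?_
    obtain ⟨M, hM⟩ := hx0 (ε / (2 * B)) (by positivity)
    have hk2 := (Metric.tendsto_nhds.1 (hx1 M)) (ε / 2) (by positivity)
    obtain ⟨N, hN⟩ := eventually_atTop.1 ((hB.and hk2).and (eventually_ge_atTop M))
    refine ⟨N, fun i hi => ?_⟩
    obtain ⟨⟨h5, h6⟩, h7⟩ := hN i hi
    rw [Real.dist_eq, sub_zero] at h6 ⊢
    rw [abs_of_nonneg (sq_nonneg _), hx4]
    have h8 := hM i h7 M le_rfl
    rw [le_div_iff₀ (by positivity)] at h8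
    have h9 := (le_abs_self _).trans (hx3 i M)
    rw [hx2 i M] at h9
    have h10 : hE.grad (U i) x * hE.grad (U i - U M) x ≤ B * hE.grad (U i - U M) x :=
      mul_le_mul_of_nonneg_right h5 (hE.grad_nonneg _ _)
    have h11 := (le_abs_self _).trans_lt h6
    linarith
  have := hsq.sqrt
  simpa [Real.sqrt_sq (hE.grad_nonneg _ _)] using this

theorem exists_eLpNorm_one_le {X : Type*} [MeasurableSpace X] {m : Measure X} [IsFiniteMeasure m]
    (p : ℝ≥0∞) (hp : 1 ≤ p) : ∃ c : ℝ≥0∞, c ≠ ∞ ∧ ∀ g : X → ℝ, AEStronglyMeasurable g m →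
      eLpNorm g 1 m ≤ eLpNorm g p m * c := by
  refine ⟨m Set.univ ^ (1 / (1 : ℝ≥0∞).toReal - 1 / p.toReal), ?_, fun g hg =>
    eLpNorm_le_eLpNorm_mul_rpow_measure_univ hp hg⟩
  refine ENNReal.rpow_ne_top_of_nonneg ?_ (measure_ne_top _ _)
  rw [ENNReal.toReal_one, sub_nonneg]
  rcases eq_or_ne p ∞ with rfl | h
  · simp
  · exact one_div_le_one_div_of_le one_pos (by simpa using ENNReal.toReal_mono h hp)

/-- A Cauchy sequence for the `p`-energy has a subsequence whose gradients are Cauchy pointwise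
almost everywhere. -/
theorem StandingAssumption.exists_subseq_grad_cauchy (hE : E.StandingAssumption A) {p : ℝ}
    (hp : 1 ≤ p) {F : ℕ → E.coreDomain A} (hF : SeminormCauchy (hE.pSeminorm hp) F) :
    ∃ ns : ℕ → ℕ, StrictMono ns ∧ ∀ᵐ x ∂m, ∀ ε : ℝ, 0 < ε → ∃ M : ℕ, ∀ i, M ≤ i → ∀ j, M ≤ j →
      hE.grad (E.ofCont (F (ns i)) - E.ofCont (F (ns j))) x ≤ ε := by
  obtain ⟨ns, hns, hN⟩ := extraction_forall_of_eventually
    (P := fun k n => ∀ j, n ≤ j → hE.pSeminorm hp (F j - F n) < (1 / 2 : ℝ) ^ k) fun k => by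
      obtain ⟨M, hM⟩ := hF ((1 / 2 : ℝ) ^ k) (by positivity)
      filter_upwards [eventually_ge_atTop M] with n hn j hj
      exact hM j (hn.trans hj) n hn
  refine ⟨ns, hns, ?_⟩
  set U : ℕ → E.FormDomain := fun i => E.ofCont (F (ns i)) with hU
  obtain ⟨c, hc, hcle⟩ := exists_eLpNorm_one_le (m := m) (ENNReal.ofReal p) (by
    rw [← ENNReal.ofReal_one]
    exact ENNReal.ofReal_le_ofReal hp)
  have hlint : ∀ k, ∫⁻ x, ENNReal.ofReal (hE.grad (U (k + 1) - U k) x) ∂m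
      ≤ ENNReal.ofReal ((1 / 2 : ℝ) ^ k) * c := by
    intro k
    have h1 : ∫⁻ x, ENNReal.ofReal (hE.grad (U (k + 1) - U k) x) ∂m
        = eLpNorm (hE.coreGrad (F (ns (k + 1)) - F (ns k))) 1 m := by
      rw [eLpNorm_one_eq_lintegral_enorm]
      refine lintegral_congr fun x => ?_
      rw [coreGrad_def, Submodule.coe_sub, map_sub, Real.enorm_of_nonneg (hE.grad_nonneg _ _)]
    rw [h1]
    refine (hcle _ (hE.memLp_coreGrad _ 1).1).trans ?_
    gcongr
    rw [← ENNReal.ofReal_toReal (hE.memLp_coreGrad _ (ENNReal.ofReal p)).2.ne]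
    exact ENNReal.ofReal_le_ofReal (hN k (ns (k + 1)) (hns.monotone (Nat.le_succ k))).le
  have hsum : ∀ᵐ x ∂m, Summable fun k => hE.grad (U (k + 1) - U k) x := by
    have h1 : ∫⁻ x, ∑' k, ENNReal.ofReal (hE.grad (U (k + 1) - U k) x) ∂m ≠ ∞ := by
      rw [lintegral_tsum fun k => (hE.aestronglyMeasurable_grad _).aemeasurable.ennreal_ofReal]
      refine ne_top_of_le_ne_top ?_ (ENNReal.tsum_le_tsum hlint)
      rw [ENNReal.tsum_mul_right]
      refine ENNReal.mul_ne_top ?_ hc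
      exact summable_geometric_two.tsum_ofReal_ne_top
    filter_upwards [ae_lt_top' (AEMeasurable.tsum fun k =>
      (hE.aestronglyMeasurable_grad _).aemeasurable.ennreal_ofReal) h1] with x hx
    have h2 := ENNReal.summable_toReal hx.ne
    simpa only [ENNReal.toReal_ofReal (hE.grad_nonneg _ _)] using h2
  have htri : ∀ᵐ x ∂m, ∀ i j, hE.grad (U (j + 1) - U i) x
      ≤ hE.grad (U (j + 1) - U j) x + hE.grad (U j - U i) x := by
    refine ae_all_iff.2 fun i => ae_all_iff.2 fun j => ?_
    have := hE.grad_add_le (U (j + 1) - U j) (U j - U i)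
    rwa [sub_add_sub_cancel] at this
  filter_upwards [hsum, htri, hE.grad_zero] with x hs ht h0
  have hle : ∀ i d, hE.grad (U (i + d) - U i) x
      ≤ ∑ k ∈ Finset.range (i + d), hE.grad (U (k + 1) - U k) x
        - ∑ k ∈ Finset.range i, hE.grad (U (k + 1) - U k) x := by
    intro i d
    induction d with
    | zero => rw [add_zero, sub_self, sub_self, h0]
    | succ d ih =>
      rw [← add_assoc, Finset.sum_range_succ]
      linarith [ht i (i + d)]
  intro ε hε
  obtain ⟨M, hM⟩ := Metric.cauchySeq_iff.1 hs.hasSum.tendsto_sum_nat.cauchySeq ε hε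
  refine ⟨M, fun i hi j hj => ?_⟩
  rcases le_total i j with h | h
  · obtain ⟨d, rfl⟩ := Nat.exists_eq_add_of_le h
    have h1 := hM _ hj _ hi
    rw [Real.dist_eq] at h1
    change hE.grad (U i - U (i + d)) x ≤ ε
    rw [hE.grad_sub_comm]
    exact (hle i d).trans ((le_abs_self _).trans h1.le)
  · obtain ⟨d, rfl⟩ := Nat.exists_eq_add_of_le h
    have h1 := hM _ hi _ hj
    rw [Real.dist_eq] at h1
    exact (hle j d).trans ((le_abs_self _).trans h1.le)

/-- A function with bounded gradient for which the integration by parts formula holds with a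
bounded generator. -/
def StandingAssumption.IsTest (hE : E.StandingAssumption A) (u : E.FormDomain) : Prop :=
  MemLp (hE.grad u) ∞ m ∧ ∃ w : Lp ℝ 2 m, MemLp w ∞ m ∧
    ∀ g : E.FormDomain, E.energy u g = -inner ℝ w (E.incl g)

theorem StandingAssumption.dense_isTest (hE : E.StandingAssumption A)
    (hG : E.GeneratorAssumption) : Dense {u | hE.IsTest u} := by
  obtain ⟨V, hV, hVd, hVΓ, hVL⟩ := hG
  intro u
  rw [Metric.mem_closure_iff]
  intro ε hε
  obtain ⟨v, hvV, hv⟩ := hVd u (ε ^ 2) (by positivity)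
  let v' : E.FormDomain := v
  refine ⟨v', ⟨?_, ?_⟩, ?_⟩
  · obtain ⟨γ, hγ, hγb⟩ := hVΓ v hvV
    rw [hE.eq_gamma_of_isEnergyDensity hγ] at hγb
    exact memLp_top_sqrt hγb
  · let w : E.generator.domain := ⟨v, hV hvV⟩
    refine ⟨E.generator w, hVL w hvV, fun g => ?_⟩
    obtain ⟨_, h⟩ := E.generatorRel_generator w
    exact h g
  · rw [normSq_eq_formDomain_norm_sq] at hv
    rw [dist_comm, dist_eq_norm]
    exact lt_of_pow_lt_pow_left₀ 2 hε.le hv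

theorem exists_ae_bound_of_memLp_top {X : Type*} [MeasurableSpace X] {m : Measure X} {g : X → ℝ}
    (hg : MemLp g ∞ m) : ∃ C : ℝ, 0 ≤ C ∧ ∀ᵐ x ∂m, |g x| ≤ C := by
  refine ⟨(eLpNorm g ∞ m).toReal, ENNReal.toReal_nonneg, ?_⟩
  have h1 := ae_le_eLpNormEssSup (f := g) (μ := m)
  rw [← eLpNorm_exponent_top] at h1
  filter_upwards [h1] with x hx
  have h2 := ENNReal.toReal_mono hg.2.ne hx
  rwa [toReal_enorm, Real.norm_eq_abs] at h2

theorem tendsto_integral_abs_of_tendsto_coreToLp {q : ℝ≥0∞} [hq : Fact (1 ≤ q)]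
    {F : ℕ → E.coreDomain A} (hF : Tendsto (fun n => E.coreToLp A q (F n)) atTop (𝓝 0)) :
    Tendsto (fun n => ∫ x, |(F n).1.1 x| ∂m) atTop (𝓝 0) := by
  obtain ⟨c, hc, hcle⟩ := exists_eLpNorm_one_le (m := m) q hq.out
  have h1 := (tendsto_coreToLp_iff (Lp.coeFn_zero ℝ q m)).1 hF
  simp only [Pi.zero_apply, sub_zero] at h1
  have h2 : Tendsto (fun n => eLpNorm (F n).1.1 q m * c) atTop (𝓝 0) := by
    have := ENNReal.Tendsto.mul_const h1 (Or.inr hc)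
    rwa [zero_mul] at this
  have h3 : Tendsto (fun n => eLpNorm (F n).1.1 1 m) atTop (𝓝 0) :=
    tendsto_of_tendsto_of_tendsto_of_le_of_le tendsto_const_nhds h2 (fun _ => bot_le)
      fun n => hcle _ (memLp_compactlySupported (F n).1.1 1).1
  have h4 := (ENNReal.tendsto_toReal ENNReal.zero_ne_top).comp h3
  refine h4.congr fun n => ?_
  rw [Function.comp_apply, eLpNorm_one_eq_lintegral_enorm,
    ← integral_norm_eq_lintegral_enorm (memLp_compactlySupported (F n).1.1 1).1]
  rfl

/-- Integration by parts against a test function `u` shows that `Γ(F n, u)` vanishes in the limit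
when it is integrated against an element `g` of the algebra `A`. -/
theorem StandingAssumption.tendsto_integral_mul_gamma (hE : E.StandingAssumption A) {q : ℝ≥0∞}
    [Fact (1 ≤ q)] {F : ℕ → E.coreDomain A}
    (hF : Tendsto (fun n => E.coreToLp A q (F n)) atTop (𝓝 0)) {u : E.FormDomain}
    (hu : hE.IsTest u) (g : E.coreDomain A) :
    Tendsto (fun n => ∫ x, g.1.1 x * hE.gamma (E.ofCont (F n)) u x ∂m) atTop (𝓝 0) := by
  obtain ⟨hu1, w, hw, hgen⟩ := hu
  obtain ⟨Cu, hCu0, hCu⟩ := exists_ae_bound_of_memLp_top hu1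
  obtain ⟨Cw, hCw0, hCw⟩ := exists_ae_bound_of_memLp_top hw
  obtain ⟨Cg, hCg0, hCg⟩ := exists_ae_bound_of_memLp_top (hE.memLp_top_coreGrad g)
  obtain ⟨Mg, hMg⟩ := exists_abs_le g.1.1
  have h0 := (tendsto_integral_abs_of_tendsto_coreToLp hF).const_mul (Cw * |Mg| + Cg * Cu)
  rw [mul_zero] at h0
  refine squeeze_zero_norm (fun n => ?_) h0
  have h1 := hE.integral_mul_gamma_add (F n : E.ContDomain) g u
  rw [E.energy_symm, hgen, incl_ofCont, inner_eq_integral] at h1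
  have h2 : ∫ x, w x * toL2 m ((F n : E.ContDomain) * (g : E.ContDomain)).1 x ∂m
      = ∫ x, (F n).1.1 x * (g.1.1 x * w x) ∂m := by
    refine integral_congr_ae ?_
    filter_upwards [coeFn_toL2 (m := m) ((F n : E.ContDomain) * (g : E.ContDomain)).1] with x hx
    rw [hx]
    change w x * ((F n).1.1 x * g.1.1 x) = _
    ring
  have hi1 : Integrable (fun x => (F n).1.1 x * (g.1.1 x * w x)) m :=
    integrable_compactlySupported_mul _
      (integrable_compactlySupported_mul _ ((Lp.memLp w).integrable (by norm_num)))
  have hi2 : Integrable (fun x => (F n).1.1 x * hE.gamma (E.ofCont (g : E.ContDomain)) u x) m :=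
    integrable_compactlySupported_mul _ (L1.integrable_coeFn _)
  have h3 : ∫ x, g.1.1 x * hE.gamma (E.ofCont (F n)) u x ∂m
      = -∫ x, (F n).1.1 x * (g.1.1 x * w x)
        + (F n).1.1 x * hE.gamma (E.ofCont (g : E.ContDomain)) u x ∂m := by
    rw [integral_add hi1 hi2, ← h2]
    linarith
  rw [h3, norm_neg, ← integral_const_mul]
  refine norm_integral_le_of_norm_le
    ((memLp_compactlySupported (F n).1.1 1).integrable le_rfl |>.abs.const_mul _) ?_
  filter_upwards [hCu, hCw, hCg, hE.abs_gamma_le (E.ofCont (g : E.ContDomain)) u]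
    with x hx1 hx2 hx3 hx4
  rw [← mul_add, norm_mul, Real.norm_eq_abs, Real.norm_eq_abs, mul_comm]
  refine mul_le_mul_of_nonneg_right ((abs_add_le _ _).trans (add_le_add ?_ ?_)) (abs_nonneg _)
  · rw [abs_mul, mul_comm]
    exact mul_le_mul hx2 ((hMg x).trans (le_abs_self _)) (abs_nonneg _) hCw0
  · refine hx4.trans ?_
    exact mul_le_mul ((le_abs_self _).trans hx3) ((le_abs_self _).trans hx1)
      (hE.grad_nonneg _ _) hCg0

theorem StandingAssumption.seminormClosable_of_generatorAssumption (hE : E.StandingAssumption A)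
    (hG : E.GeneratorAssumption) {p : ℝ} (hp : 1 ≤ p) [hp' : Fact (1 ≤ ENNReal.ofReal p)] :
    SeminormClosable (hE.pSeminorm hp) (E.coreToLp A (ENNReal.ofReal p)) := by
  intro F hF hF0
  obtain ⟨ns, hns, hcau⟩ := hE.exists_subseq_grad_cauchy hp hF
  refine hE.tendsto_pSeminorm_of_subseq hp hF hns
    (hE.tendsto_grad_of_weak (hE.dense_isTest hG) hcau fun u hu => ?_)
  obtain ⟨Cu, hCu0, hCu⟩ := exists_ae_bound_of_memLp_top hu.1
  -- The densities `Γ(F n, u)` converge to zero in `L¹`.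
  have hL1 : Tendsto (fun n => hE.gamma (E.ofCont (F n)) u) atTop (𝓝 0) := by
    obtain ⟨c, hc, hcle⟩ := exists_eLpNorm_one_le (m := m) (ENNReal.ofReal p) hp'.out
    have hb : ∀ n k, ‖hE.gamma (E.ofCont (F n)) u - hE.gamma (E.ofCont (F k)) u‖
        ≤ Cu * c.toReal * hE.pSeminorm hp (F n - F k) := by
      intro n k
      have h1 : ‖hE.gamma (E.ofCont (F n)) u - hE.gamma (E.ofCont (F k)) u‖
          ≤ Cu * ∫ x, hE.coreGrad (F n - F k) x ∂m := by
        rw [← LinearMap.sub_apply, ← map_sub, ← map_sub, ← Submodule.coe_sub,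
          L1.norm_eq_integral_norm, ← integral_const_mul]
        refine integral_mono_ae (L1.integrable_coeFn _).norm
          (((hE.memLp_coreGrad (F n - F k) 1).integrable le_rfl).const_mul _) ?_
        filter_upwards [hCu, hE.abs_gamma_le (E.ofCont (F n - F k : E.coreDomain A)) u]
          with x hx1 hx2
        rw [mul_comm]
        exact hx2.trans (mul_le_mul_of_nonneg_left ((le_abs_self _).trans hx1)
          (hE.grad_nonneg _ _))
      have h2 : ∫ x, hE.coreGrad (F n - F k) x ∂m
          ≤ hE.pSeminorm hp (F n - F k) * c.toReal := by
        have h3 := ENNReal.toReal_mono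
          (ENNReal.mul_ne_top (hE.memLp_coreGrad (F n - F k) _).2.ne hc)
          (hcle _ (hE.memLp_coreGrad (F n - F k) 1).1)
        rw [ENNReal.toReal_mul, eLpNorm_one_eq_lintegral_enorm,
          ← integral_norm_eq_lintegral_enorm (hE.memLp_coreGrad (F n - F k) 1).1] at h3
        refine le_trans (le_of_eq (integral_congr_ae (Eventually.of_forall fun x => ?_))) h3
        exact (Real.norm_of_nonneg (hE.grad_nonneg _ _)).symm
      calc _ ≤ _ := h1
        _ ≤ Cu * (hE.pSeminorm hp (F n - F k) * c.toReal) := mul_le_mul_of_nonneg_left h2 hCu0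
        _ = _ := by ring
    have hcs : CauchySeq fun n => hE.gamma (E.ofCont (F n)) u := by
      refine Metric.cauchySeq_iff.2 fun ε hε => ?_
      have hK : 0 < Cu * c.toReal + 1 := by positivity
      obtain ⟨M, hM⟩ := hF (ε / (Cu * c.toReal + 1)) (by positivity)
      refine ⟨M, fun n hn k hk => ?_⟩
      have h1 := hM n hn k hk
      rw [lt_div_iff₀ hK] at h1
      rw [dist_eq_norm]
      have := apply_nonneg (hE.pSeminorm hp) (F n - F k)
      linarith [hb n k]
    obtain ⟨ξ, hξ⟩ := cauchySeq_tendsto_of_complete hcs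
    have h0 : ξ = 0 := by
      have h1 := ae_eq_zero_of_forall_integral_sq_mul_eq_zero hE.core.uniformly_dense
        (L1.integrable_coeFn ξ) fun f hf => by
          have h2 := hE.tendsto_integral_mul_gamma hF0 hu (hE.toCore (f * f) (A.mul_mem hf hf))
          have h3 := ((continuous_integral_compactlySupported_mul (f * f)).tendsto ξ).comp hξ
          exact tendsto_nhds_unique h3 h2
      refine Lp.ext ?_
      filter_upwards [h1, Lp.coeFn_zero ℝ 1 m] with x hx1 hx2
      rw [hx1, hx2]
    rwa [h0] at hξ
  -- Pointwise, `Γ(F (ns i), u)` is a Cauchy sequence, so its limit is zero as well.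
  obtain ⟨ks, hks, h1⟩ := (tendstoInMeasure_of_tendsto_Lp
    (hL1.comp hns.tendsto_atTop)).exists_seq_tendsto_ae
  have h2 : ∀ᵐ x ∂m, ∀ i j, |hE.gamma (E.ofCont (F (ns i))) u x
      - hE.gamma (E.ofCont (F (ns j))) u x|
      ≤ hE.grad (E.ofCont (F (ns i)) - E.ofCont (F (ns j))) x * hE.grad u x := by
    refine ae_all_iff.2 fun i => ae_all_iff.2 fun j => ?_
    filter_upwards [hE.abs_gamma_le (E.ofCont (F (ns i)) - E.ofCont (F (ns j))) u,
      ae_bilin_sub hE.gamma (E.ofCont (F (ns i))) (E.ofCont (F (ns j))) u] with x hx1 hx2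
    rwa [hx2] at hx1
  filter_upwards [hcau, h1, h2, Lp.coeFn_zero ℝ 1 m] with x hx0 hx1 hx2 hx3
  rw [hx3] at hx1
  have hcs : CauchySeq fun i => hE.gamma (E.ofCont (F (ns i))) u x := by
    refine Metric.cauchySeq_iff.2 fun ε hε => ?_
    have hK : 0 < hE.grad u x + 1 := by
      have := hE.grad_nonneg u x
      positivity
    obtain ⟨M, hM⟩ := hx0 (ε / (2 * (hE.grad u x + 1))) (by positivity)
    refine ⟨M, fun i hi j hj => ?_⟩
    have h3 := hM i hi j hj
    rw [le_div_iff₀ (by positivity)] at h3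
    rw [Real.dist_eq]
    have h4 := hE.grad_nonneg (E.ofCont (F (ns i)) - E.ofCont (F (ns j))) x
    nlinarith [hx2 i j]
  obtain ⟨l, hl⟩ := cauchySeq_tendsto_of_complete hcs
  have h3 : l = 0 := tendsto_nhds_unique (hl.comp hks.tendsto_atTop) hx1
  rwa [h3] at hl

end GeneratorCase

end DirichletForm

theorem theorem2p1 {X : Type*} [MetricSpace X] [LocallyCompactSpace X]
    [TopologicalSpace.SeparableSpace X] [MeasurableSpace X] [BorelSpace X]
    (m : Measure X) [IsFiniteMeasure m] [m.IsOpenPosMeasure]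
    (E : DirichletForm m) (A : NonUnitalSubalgebra ℝ C_c(X, ℝ))
    (hEA : E.StandingAssumption A) :
    (∀ p : ℝ, 2 ≤ p → E.IsPClosable A p ∧ E.SobolevSpaceIsBanach A p) ∧
    (E.GeneratorAssumption → ∀ p : ℝ, 1 < p → p < 2 →
      E.IsPClosable A p ∧ E.SobolevSpaceIsBanach A p) := by
  have : SecondCountableTopology X := UniformSpace.secondCountable_of_separable X
  constructor
  · intro p hp
    have hp1 : 1 ≤ p := by linarith
    have : Fact (1 ≤ ENNReal.ofReal p) := ⟨by rwa [ENNReal.one_le_ofReal]⟩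
    exact hEA.isPClosable_and_sobolevSpaceIsBanach hp1 (hEA.seminormClosable_of_two_le hp1 hp)
  · intro hG p hp _
    have : Fact (1 ≤ ENNReal.ofReal p) := ⟨by rw [ENNReal.one_le_ofReal]; exact hp.le⟩
    exact hEA.isPClosable_and_sobolevSpaceIsBanach hp.le
      (hEA.seminormClosable_of_generatorAssumption hG hp.le)
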